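/- There are $n$ bidders and one item. Bidder $i$ has a value in $[0,1]$ drawn from a distribution $D_i$, independently of the other bidders; put $D=D_1\times\dots\times D_n$. A mechanism $h$ maps a reported profile $v\in[0,1]^n$ to allocation probabilities and payments $p_i^h(v)$; its revenue on $v$ is $\mathrm{r}(h,v)=\sum_i p_i^h(v)$ and its expected revenue is $\mathrm{R}_D(h)=\mathbb{E}_{v\sim D}[\mathrm{r}(h,v)]$. Let $H$ be the class of all dominant strategy truthful, individually rational single-item mechanisms (with finite expected revenue). Let $H_{SP}$ be the class of second-price auctions with bidder-specific reserves $r\in[0,1]^n$: bidders with $v_i<r_i$ are removed, the highest remaining bidder wins (ties go to the smallest index) and pays the maximum of its own reserve and the bids of the other remaining bidders. Fix an ERM process for $H_{SP}$: on every finite sample (multiset) $T$ of profiles it outputs some $h_T\in H_{SP}$ that maximizes the empirical revenue $\frac1{|T|}\sum_{v\in T}\mathrm{r}(h,v)$ over $h\in H_{SP}$, and, whenever some maximizer has the property that each reserve $r_i$ equals the value of bidder $i$ in some profile of $T$, the output has this property. Let $\hat H_S=\{h_T: T\subseteq S,\ |T|=\lceil |S|/2\rceil\}$, where $h_T$ is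 identified with its vector of reserves, and let $\hat\tau(m)=\sup_{|S|=m}|\hat H_S|$ be the split-sample growth rate. Then for all $m\ge 1$: 1. $\hat\tau(m)\le m^n$. 2. If $S$ consists of $m$ i.i.d. profiles drawn from $D$, then $$\mathbb{E}_S[\mathrm{R}_D(h_S)]\ \ge\ \sup_{h\in H_{SP}}\mathrm{R}_D(h)-\sqrt{\frac{2n\log(2m)}{m}}.$$ 3. If moreover every $D_i$ is regular, i.e. its revenue curve $q\mapsto q\cdot v_i(q)$ is concave on $[0,1]$, where $v_i(q)=\sup\{p\in[0,1]:\Pr_{x\sim D_i}[x\ge p]\ge q\}$ (for a distribution with distribution function $F_i$ and positive density $f_i$ on an interval: the virtual value $v-\frac{1-F_i(v)}{f_i(v)}$ is nondecreasing), then $\sup_{h\in H_{SP}}\mathrm{R}_D(h)\ge\frac12\sup_{h\in H}\mathrm{R}_D(h)$ and $$\mathbb{E}_S[\mathrm{R}_D(h_S)]\ \ge\ \frac12\sup_{h\in H}\mathrm{R}_D(h)-\sqrt{\frac{2n\log(2m)}{m}}.$$ -/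

import Mathlib

open MeasureTheory
open scoped unitInterval

noncomputable section

/-! ### Empirical reward maximization and the split-sample growth rate -/

/-- The average reward of the hypothesis `h` on the finite sample `T` (a multiset, so that repeated
observations are counted with multiplicity). -/
def empiricalReward {H Z : Type*} (rew : H → Z → ℝ) (T : Multiset Z) (h : H) : ℝ :=
  (T.map (rew h)).sum / (Multiset.card T : ℝ)

/-- `erm` is an empirical reward maximization process: on every sample it outputs a hypothesis that
maximizes the empirical reward, ties being broken in a way that is fixed by `erm` itself. -/
def IsERM {H Z : Type*} (rew : H → Z → ℝ) (erm : Multiset Z → H) : Prop :=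
  ∀ T : Multiset Z, IsMaxOn (empiricalReward rew T) Set.univ (erm T)

/-- All hypotheses that `erm` outputs on sub-samples of `S` of size `⌈|S| / 2⌉`. -/
def splitSampleSpace {H Z : Type*} (erm : Multiset Z → H) (S : Multiset Z) : Set H :=
  {h | ∃ T : Multiset Z, T ≤ S ∧ Multiset.card T = ⌈(Multiset.card S : ℚ) / 2⌉₊ ∧ erm T = h}

/-- The largest size of the split-sample hypothesis space of a sample of size `m`. -/
def splitSampleGrowth {H Z : Type*} (erm : Multiset Z → H) (m : ℕ) : ℕ∞ :=
  ⨆ (S : Multiset Z) (_ : Multiset.card S = m), (splitSampleSpace erm S).encard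

/-- The sample of size `m` formed by the observations `z 0, …, z (m - 1)`. -/
def sampleOf {Z : Type*} {m : ℕ} (z : Fin m → Z) : Multiset Z :=
  Finset.univ.val.map z

/-! ### Single-item mechanisms -/

/-- Profiles of values (equivalently, of bids) of `n` bidders, each in `[0, 1]`. -/
abbrev Profile (n : ℕ) : Type := Fin n → I

/-- A direct mechanism for one item: the probability with which each bidder gets the item, and the
payment of each bidder, as functions of the reported profile. -/
structure Mechanism (n : ℕ) where
  alloc : Profile n → Fin n → ℝ
  pay : Profile n → Fin n → ℝ

namespace Mechanism

variable {n : ℕ}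

/-- The revenue of a mechanism on a profile: the sum of the payments. -/
def revenue (h : Mechanism n) (v : Profile n) : ℝ := ∑ i, h.pay v i

/-- The expected revenue of a mechanism when the profile of values has law `D`. -/
def expectedRevenue (D : Measure (Profile n)) (h : Mechanism n) : ℝ := ∫ v, h.revenue v ∂D

/-- Dominant strategy truthful, individually rational, feasible (measurable) single-item
mechanisms. Payments may be negative. -/
structure IsTruthful (h : Mechanism n) : Prop where
  measurable_alloc : ∀ i, Measurable fun v => h.alloc v i
  measurable_pay : ∀ i, Measurable fun v => h.pay v i
  alloc_nonneg : ∀ v i, 0 ≤ h.alloc v i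
  sum_alloc_le_one : ∀ v, ∑ i, h.alloc v i ≤ 1
  dominant_strategy : ∀ (i : Fin n) (v : Profile n) (b : I),
    (v i : ℝ) * h.alloc (Function.update v i b) i - h.pay (Function.update v i b) i
      ≤ (v i : ℝ) * h.alloc v i - h.pay v i
  individually_rational : ∀ (i : Fin n) (v : Profile n), 0 ≤ (v i : ℝ) * h.alloc v i - h.pay v i

/-- All truthful mechanisms whose expected revenue under `D` is defined and finite. -/
def truthfulClass (D : Measure (Profile n)) : Set (Mechanism n) :=
  {h | h.IsTruthful ∧ Integrable h.revenue D}

/-- The bidders whose bid meets their own reserve. -/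
def eligible (r : Fin n → I) (v : Profile n) : Finset (Fin n) :=
  Finset.univ.filter fun i => r i ≤ v i

/-- Bidder `i` wins the second-price auction with reserves `r`: it is eligible and has the highest
bid among the eligible bidders; ties go to the smallest index. -/
def Wins (r : Fin n → I) (v : Profile n) (i : Fin n) : Prop :=
  i ∈ eligible r v ∧ ∀ j ∈ eligible r v, v j < v i ∨ (v j = v i ∧ i ≤ j)

open Classical in
/-- The second-price auction with bidder-specific reserves `r`: bidders who bid less than their
reserve are removed, the highest remaining bidder gets the item and pays the maximum of its own
reserve and of the bids of the other remaining bidders. -/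
def secondPrice (r : Fin n → I) : Mechanism n where
  alloc v i := if Wins r v i then 1 else 0
  pay v i := if Wins r v i then ((r i ⊔ ((eligible r v).erase i).sup v : I) : ℝ) else 0

/-- All second-price auctions with bidder-specific reserves in `[0, 1]`. -/
def secondPriceClass (n : ℕ) : Set (Mechanism n) := Set.range (secondPrice (n := n))

end Mechanism

/-- The tie-breaking rule: whenever some optimal vector of reserves on the sample `T` consists of
values in the sample (the reserve of each bidder `i` being the value of bidder `i` in some profile
of `T`), the output on `T` is of this kind. -/
def FavorsSampleValues {n : ℕ} (erm : Multiset (Profile n) → (Fin n → I)) : Prop :=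
  ∀ T : Multiset (Profile n),
    (∃ r : Fin n → I,
      IsMaxOn (empiricalReward (fun r v => (Mechanism.secondPrice r).revenue v) T) Set.univ r ∧
        ∀ i, ∃ v ∈ T, r i = v i) →
    ∀ i, ∃ v ∈ T, erm T i = v i

/-! ### Regular distributions -/

/-- The value at quantile `q`: the highest price in `[0, 1]` at which a bidder with value
distribution `μ` buys with probability at least `q`. -/
def valueAtQuantile (μ : Measure I) (q : ℝ) : ℝ :=
  sSup {p : ℝ | p ∈ Set.Icc (0 : ℝ) 1 ∧ q ≤ μ.real {x : I | p ≤ (x : ℝ)}}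

/-- A distribution is regular if its revenue curve `q ↦ q * v(q)` in quantile space is concave.
If `μ` has a distribution function `F` and a positive density `f` on an interval, then the slope of
this curve at `q = 1 - F v` is the virtual value `v - (1 - F v) / f v`, so this says that the virtual
value is nondecreasing. The definition also covers such distributions when they are capped from
above, which creates an atom at the cap. -/
def IsRegularDistribution (μ : Measure I) : Prop :=
  ConcaveOn ℝ (Set.Icc (0 : ℝ) 1) fun q => q * valueAtQuantile μ q

end

/-!
Keeping the same bidders eligible, the reserves can be raised to values that occur in the sample, so
the tie-breaking rule forces empirical optimizers to have reserves of that kind, and a sample of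
size `m` leaves at most `m ^ n` of them. For the learning bound, compare the training sample with an
independent hold-out sample of the same size `m`. Exchanging pairs of observations between the two
does not change their joint law, and whatever is exchanged, the learnt reserves are optimal on half
of the same `2 * m` observations. So only `(2 * m) ^ n` auctions are ever compared, and Massart's
finite class lemma bounds the gap.

For regular distributions, the revenue curve makes the posted-price revenue antitone above the
optimal price `r`, hence the tail function of a measure, whose density is the nonnegative virtual
value. Myerson's bound (the payments of a truthful mechanism are at most its virtual surplus, with
equality for the second-price auction) then follows by integrating over the level sets of the
monotone allocation, without densities. Finally, every bidder's virtual value is at most the virtual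
value of the winner of the second-price auction with reserves `r` plus the price that the winner
pays, because those who lose have values below that price. Both terms have expectation at most the
revenue of that auction, hence the factor `2`.
-/

/-! ### Second-price auctions with reserves -/

namespace Mechanism

variable {n : ℕ} {r r' : Fin n → I} {v : Profile n} {i j : Fin n}

theorem mem_eligible : i ∈ eligible r v ↔ r i ≤ v i := by
  simp [eligible]

theorem Wins.le (hi : Wins r v i) (hj : j ∈ eligible r v) : v j ≤ v i :=
  (hi.2 j hj).elim le_of_lt fun h => h.1.le

theorem Wins.eq (hi : Wins r v i) (hj : Wins r v j) : i = j := by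
  have hv : v i = v j := le_antisymm (hj.le hi.1) (hi.le hj.1)
  have hij : i ≤ j := ((hi.2 j hj.1).resolve_left hv.not_gt).2
  have hji : j ≤ i := ((hj.2 i hi.1).resolve_left hv.symm.not_gt).2
  exact le_antisymm hij hji

theorem exists_wins (h : (eligible r v).Nonempty) : ∃ i, Wins r v i := by
  obtain ⟨i, hi, hmax⟩ := Finset.exists_max_image (eligible r v)
    (fun i => toLex (v i, OrderDual.toDual i)) h
  exact ⟨i, hi, fun j hj => by simpa [Prod.Lex.toLex_le_toLex] using hmax j hj⟩

/-- The price at which the second-price auction with reserves `r` offers the item to bidder `i`: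
the maximum of the reserve of `i` and of the bids of the other eligible bidders. It does not depend
on the bid of `i`, and it is what `i` pays in case of winning. -/
noncomputable def price (r : Fin n → I) (v : Profile n) (i : Fin n) : I :=
  r i ⊔ ((eligible r v).erase i).sup v

theorem secondPrice_alloc_of_wins (h : Wins r v i) : (secondPrice r).alloc v i = 1 :=
  if_pos h

theorem secondPrice_alloc_of_not_wins (h : ¬ Wins r v i) : (secondPrice r).alloc v i = 0 :=
  if_neg h

theorem secondPrice_pay_of_wins (h : Wins r v i) : (secondPrice r).pay v i = price r v i :=
  if_pos h

theorem secondPrice_pay_of_not_wins (h : ¬ Wins r v i) : (secondPrice r).pay v i = 0 :=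
  if_neg h

theorem le_price_of_ne (hj : j ∈ eligible r v) (hij : j ≠ i) : v j ≤ price r v i :=
  le_sup_of_le_right (Finset.le_sup (f := v) (Finset.mem_erase.2 ⟨hij, hj⟩))

theorem Wins.price_le (h : Wins r v i) : price r v i ≤ v i :=
  sup_le (mem_eligible.1 h.1) (Finset.sup_le fun _ hj => h.le (Finset.mem_of_mem_erase hj))

theorem wins_of_price_lt (h : price r v i < v i) : Wins r v i :=
  ⟨mem_eligible.2 (le_sup_left.trans h.le), fun j hj => (eq_or_ne j i).elim
    (fun hji => hji ▸ Or.inr ⟨rfl, le_rfl⟩) fun hji => Or.inl ((le_price_of_ne hj hji).trans_lt h)⟩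

theorem price_update (r : Fin n → I) (v : Profile n) (i : Fin n) (b : I) :
    price r (Function.update v i b) i = price r v i := by
  have herase : (eligible r (Function.update v i b)).erase i = (eligible r v).erase i := by
    ext j
    simp +contextual [mem_eligible]
  unfold price
  rw [herase]
  refine congrArg _ (Finset.sup_congr rfl fun j hj => ?_)
  rw [Function.update_of_ne (Finset.ne_of_mem_erase hj)]

theorem secondPrice_revenue_of_wins (h : Wins r v i) : (secondPrice r).revenue v = price r v i := by
  rw [revenue, Finset.sum_eq_single i _ (by simp), secondPrice_pay_of_wins h]
  exact fun j _ hj => secondPrice_pay_of_not_wins fun hw => hj (hw.eq h)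

theorem secondPrice_revenue_of_eligible_eq_empty (h : eligible r v = ∅) :
    (secondPrice r).revenue v = 0 :=
  Finset.sum_eq_zero fun i _ => secondPrice_pay_of_not_wins fun hw => by simpa [h] using hw.1

theorem secondPrice_pay_nonneg : 0 ≤ (secondPrice r).pay v i := by
  by_cases h : Wins r v i
  · exact (secondPrice_pay_of_wins h).symm ▸ (price r v i).2.1
  · exact (secondPrice_pay_of_not_wins h).ge

theorem secondPrice_revenue_nonneg : 0 ≤ (secondPrice r).revenue v :=
  Finset.sum_nonneg fun _ _ => secondPrice_pay_nonneg

theorem secondPrice_revenue_le_one : (secondPrice r).revenue v ≤ 1 := by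
  rcases (eligible r v).eq_empty_or_nonempty with h | h
  · exact (secondPrice_revenue_of_eligible_eq_empty h).trans_le zero_le_one
  · obtain ⟨i, hi⟩ := exists_wins h
    exact (secondPrice_revenue_of_wins hi).trans_le (price r v i).2.2

theorem secondPrice_revenue_le_of_eligible_subset (hE : eligible r v ⊆ eligible r' v)
    (hr : ∀ i ∈ eligible r v, r i ≤ r' i) :
    (secondPrice r).revenue v ≤ (secondPrice r').revenue v := by
  rcases (eligible r v).eq_empty_or_nonempty with h | h
  · exact (secondPrice_revenue_of_eligible_eq_empty h).trans_le secondPrice_revenue_nonneg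
  obtain ⟨i, hi⟩ := exists_wins h
  obtain ⟨j, hj⟩ := exists_wins (h.mono hE)
  rw [secondPrice_revenue_of_wins hi, secondPrice_revenue_of_wins hj, Subtype.coe_le_coe]
  rcases eq_or_ne i j with rfl | hij
  · exact sup_le_sup (hr i hi.1) (Finset.sup_mono (Finset.erase_subset_erase _ hE))
  · exact hi.price_le.trans (le_price_of_ne (hE hi.1) hij)

theorem measurableSet_wins (i : Fin n) :
    MeasurableSet {p : (Fin n → I) × Profile n | Wins p.1 p.2 i} := by
  simp only [Wins, mem_eligible]
  measurability

theorem measurable_price (i : Fin n) :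
    Measurable fun p : (Fin n → I) × Profile n => price p.1 p.2 i := by
  have hsup (p : (Fin n → I) × Profile n) : ((eligible p.1 p.2).erase i).sup p.2 =
      (Finset.univ.erase i).sup
        (fun j (p : (Fin n → I) × Profile n) => if p.1 j ≤ p.2 j then p.2 j else ⊥) p := by
    rw [Finset.sup_apply, eligible, ← Finset.filter_erase, Finset.sup_ite]
    simp
  simp only [price, hsup]
  refine Measurable.sup (by fun_prop) (Finset.sup_induction (p := Measurable) measurable_const
    (fun _ h _ h' => h.sup h') fun j _ => ?_)
  exact Measurable.ite (measurableSet_le (by fun_prop) (by fun_prop)) (by fun_prop)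
    measurable_const

variable {Ω : Type*} [MeasurableSpace Ω] {ρ : Ω → Fin n → I} {w : Ω → Profile n}

theorem measurable_secondPrice_alloc (hρ : Measurable ρ) (hw : Measurable w) (i : Fin n) :
    Measurable fun ω => (secondPrice (ρ ω)).alloc (w ω) i :=
  Measurable.ite (hρ.prodMk hw (measurableSet_wins i)) measurable_const measurable_const

theorem measurable_secondPrice_pay (hρ : Measurable ρ) (hw : Measurable w) (i : Fin n) :
    Measurable fun ω => (secondPrice (ρ ω)).pay (w ω) i :=
  Measurable.ite (hρ.prodMk hw (measurableSet_wins i))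
    ((measurable_price i).comp (hρ.prodMk hw)).subtype_val measurable_const

theorem measurable_secondPrice_revenue (hρ : Measurable ρ) (hw : Measurable w) :
    Measurable fun ω => (secondPrice (ρ ω)).revenue (w ω) :=
  Finset.measurable_sum _ fun i _ => measurable_secondPrice_pay hρ hw i

end Mechanism

theorem encard_setOf_forall_exists_mem_apply_eq_le {ι α : Type*} [Fintype ι]
    (S : Multiset (ι → α)) :
    {r : ι → α | ∀ i, ∃ v ∈ S, r i = v i}.encard ≤ (Multiset.card S : ℕ∞) ^ Fintype.card ι := by
  classical
  let grid : Finset (ι → α) := Fintype.piFinset fun i => (S.map fun v => v i).toFinset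
  have hgrid : {r : ι → α | ∀ i, ∃ v ∈ S, r i = v i} = grid := by
    ext r
    simp [grid, eq_comm]
  have hcard : grid.card ≤ Multiset.card S ^ Fintype.card ι :=
    (Fintype.card_piFinset _).trans_le <| Finset.prod_le_pow_card _ _ _ fun i _ =>
      (Multiset.toFinset_card_le _).trans_eq (Multiset.card_map _ _)
  rw [hgrid, Set.encard_coe_eq_coe_finsetCard]
  exact_mod_cast hcard

theorem empiricalReward_mono {H Z : Type*} {rew : H → Z → ℝ} {T : Multiset Z} {h h' : H}
    (hle : ∀ z ∈ T, rew h z ≤ rew h' z) : empiricalReward rew T h ≤ empiricalReward rew T h' :=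
  div_le_div_of_nonneg_right (Multiset.sum_map_le_sum_map _ _ hle) (Nat.cast_nonneg _)

theorem exists_mem_forall_le_and_le_of_le {Z α : Type*} [LinearOrder α] {T : Multiset Z}
    (hT : T ≠ 0) (f : Z → α) (a : α) : ∃ v ∈ T, ∀ w ∈ T, a ≤ f w → a ≤ f v ∧ f v ≤ f w := by
  classical
  rcases (T.toFinset.filter fun w => a ≤ f w).eq_empty_or_nonempty with hempty | hne
  · obtain ⟨v, hv⟩ := Multiset.exists_mem_of_ne_zero hT
    exact ⟨v, hv, fun w hw haw =>
      absurd haw (Finset.filter_eq_empty_iff.1 hempty (Multiset.mem_toFinset.2 hw))⟩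
  · obtain ⟨v, hv, hmin⟩ := Finset.exists_min_image _ f hne
    simp only [Finset.mem_filter, Multiset.mem_toFinset] at hv hmin
    exact ⟨v, hv.1, fun w hw haw => ⟨hv.2, hmin w ⟨hw, haw⟩⟩⟩

section SampleReserves

variable {n : ℕ} {erm : Multiset (Profile n) → (Fin n → I)}

/-- Raising the reserve of bidder `i` to the least value of `i` in the sample that meets it keeps
the same bidders eligible on the sample. -/
theorem exists_mem_eq_erm_apply (hERM : IsERM (fun r v => (Mechanism.secondPrice r).revenue v) erm)
    (hTie : FavorsSampleValues erm) {T : Multiset (Profile n)} (hT : T ≠ 0) (i : Fin n) :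
    ∃ v ∈ T, erm T i = v i := by
  choose s hsT hs using fun i =>
    exists_mem_forall_le_and_le_of_le hT (fun v : Profile n => v i) (erm T i)
  refine hTie T ⟨fun i => s i i, fun r _ => ?_, fun i => ⟨s i, hsT i, rfl⟩⟩ i
  refine (hERM T (Set.mem_univ r)).trans (empiricalReward_mono fun v hv => ?_)
  refine Mechanism.secondPrice_revenue_le_of_eligible_subset (fun i hi => ?_) fun i hi => ?_
  · exact Mechanism.mem_eligible.2 (hs i v hv (Mechanism.mem_eligible.1 hi)).2
  · exact (hs i v hv (Mechanism.mem_eligible.1 hi)).1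

theorem splitSampleGrowth_erm_le
    (hERM : IsERM (fun r v => (Mechanism.secondPrice r).revenue v) erm)
    (hTie : FavorsSampleValues erm) {m : ℕ} (hm : 1 ≤ m) :
    splitSampleGrowth erm m ≤ (m : ℕ∞) ^ n := by
  refine iSup₂_le fun S hS => ?_
  have hsub : splitSampleSpace erm S ⊆ {r | ∀ i, ∃ v ∈ S, r i = v i} := by
    rintro _ ⟨T, hTS, hcard, rfl⟩ i
    have hT : T ≠ 0 := by
      rw [← Multiset.card_pos, hcard, Nat.ceil_pos, hS]
      positivity
    obtain ⟨v, hv, h⟩ := exists_mem_eq_erm_apply hERM hTie hT i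
    exact ⟨v, Multiset.mem_of_le hTS hv, h⟩
  calc (splitSampleSpace erm S).encard
      ≤ {r : Fin n → I | ∀ i, ∃ v ∈ S, r i = v i}.encard := Set.encard_le_encard hsub
    _ ≤ (m : ℕ∞) ^ n := by
      simpa only [hS, Fintype.card_fin] using encard_setOf_forall_exists_mem_apply_eq_le S

end SampleReserves

/-! ### Generalization of empirical reward maximization -/

section RandomSigns

open Finset Real
open scoped BigOperators

theorem exp_expect_le {κ : Type*} [Fintype κ] [Nonempty κ] (y : κ → ℝ) :
    exp (𝔼 k, y k) ≤ 𝔼 k, exp (y k) := by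
  have htangent (k : κ) : exp (𝔼 k, y k) * (y k - 𝔼 k, y k + 1) ≤ exp (y k) := by
    calc exp (𝔼 k, y k) * (y k - 𝔼 k, y k + 1)
        ≤ exp (𝔼 k, y k) * exp (y k - 𝔼 k, y k) := by gcongr; exact add_one_le_exp _
      _ = exp (y k) := by rw [← exp_add, add_sub_cancel]
  calc exp (𝔼 k, y k) = 𝔼 k, exp (𝔼 k, y k) * (y k - 𝔼 k, y k + 1) := by
        simp only [← mul_expect, expect_add_distrib, expect_sub_distrib, Fintype.expect_const,
          sub_self, zero_add, mul_one]
    _ ≤ 𝔼 k, exp (y k) := expect_le_expect fun k _ => htangent k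

theorem expect_exp_sum_units_mul_le {ι : Type*} [Fintype ι] [DecidableEq ι] (a : ι → ℝ) :
    𝔼 ε : ι → ℤˣ, exp (∑ t, (ε t : ℤ) * a t) ≤ exp ((∑ t, a t ^ 2) / 2) := by
  have hsigns (t : ι) : ∑ s : ℤˣ, exp ((s : ℤ) * a t) = 2 * cosh (a t) := by
    rw [UnitsInt.univ, sum_pair (by decide), cosh_eq, mul_div_cancel₀ _ two_ne_zero]
    simp only [Units.val_one, Units.val_neg, Int.cast_one, Int.cast_neg, one_mul, neg_one_mul]
  calc 𝔼 ε : ι → ℤˣ, exp (∑ t, (ε t : ℤ) * a t)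
      = (∏ t, ∑ s : ℤˣ, exp ((s : ℤ) * a t)) / 2 ^ Fintype.card ι := by
        rw [Fintype.expect_eq_sum_div_card, prod_univ_sum, Fintype.piFinset_univ]
        simp [exp_sum]
    _ = ∏ t, cosh (a t) := by
        simp only [hsigns, prod_mul_distrib, prod_const, card_univ]
        exact mul_div_cancel_left₀ _ (by positivity)
    _ ≤ ∏ t, exp (a t ^ 2 / 2) :=
        prod_le_prod (fun t _ => (cosh_pos _).le) fun t _ => cosh_le_exp_half_sq _
    _ = exp ((∑ t, a t ^ 2) / 2) := by rw [← exp_sum, sum_div]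

theorem le_sqrt_of_forall_mul_le {x L V : ℝ} (h : ∀ l : ℝ, l * x ≤ L + l ^ 2 * V / 2) :
    x ≤ √(2 * V * L) := by
  have hdiscr : discrim (V / 2) (-x) L ≤ 0 := discrim_le_zero fun l => by linarith [h l]
  rw [discrim] at hdiscr
  exact le_sqrt_of_sq_le (by linarith)

/-- **Massart's finite class lemma**, with the maximum over the class replaced by an arbitrary
sign-dependent choice from it. -/
theorem expect_sum_units_mul_le_sqrt {ι H : Type*} [Fintype ι] [DecidableEq ι] {A : Finset H}
    {a : H → ι → ℝ} {V : ℝ} (ha : ∀ h ∈ A, ∑ t, a h t ^ 2 ≤ V) {f : (ι → ℤˣ) → H}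
    (hf : ∀ ε, f ε ∈ A) :
    𝔼 ε : ι → ℤˣ, ∑ t, (ε t : ℤ) * a (f ε) t ≤ √(2 * V * log #A) := by
  refine le_sqrt_of_forall_mul_le fun l => ?_
  have hA : (0 : ℝ) < #A := by exact_mod_cast card_pos.2 ⟨_, hf 1⟩
  rw [← exp_le_exp, exp_add, exp_log hA]
  calc exp (l * 𝔼 ε : ι → ℤˣ, ∑ t, (ε t : ℤ) * a (f ε) t)
      ≤ 𝔼 ε : ι → ℤˣ, exp (∑ t, (ε t : ℤ) * (l * a (f ε) t)) := by
        refine (mul_expect _ _ l ▸ exp_expect_le _).trans_eq (expect_congr rfl fun ε _ => ?_)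
        simp only [mul_sum, mul_left_comm]
    _ ≤ 𝔼 ε : ι → ℤˣ, ∑ h ∈ A, exp (∑ t, (ε t : ℤ) * (l * a h t)) :=
        expect_le_expect fun ε _ => single_le_sum
          (f := fun h => exp (∑ t, (ε t : ℤ) * (l * a h t))) (fun h _ => (exp_pos _).le) (hf ε)
    _ = ∑ h ∈ A, 𝔼 ε : ι → ℤˣ, exp (∑ t, (ε t : ℤ) * (l * a h t)) := expect_sum_comm _ _ _
    _ ≤ ∑ h ∈ A, exp (l ^ 2 * V / 2) := by
        refine sum_le_sum fun h hh => (expect_exp_sum_units_mul_le _).trans (exp_le_exp.2 ?_)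
        simp only [mul_pow, ← mul_sum]
        gcongr
        exact ha h hh
    _ = #A * exp (l ^ 2 * V / 2) := by rw [sum_const, nsmul_eq_mul]

end RandomSigns

section Symmetrization

open scoped BigOperators

variable {Z : Type*} {m : ℕ}

theorem integral_comp_of_measurePreserving {Ω Ω' : Type*} [MeasurableSpace Ω] [MeasurableSpace Ω']
    {P : Measure Ω} {Q : Measure Ω'} {T : Ω → Ω'} (hT : MeasurePreserving T P Q) {G : Ω' → ℝ}
    (hG : AEStronglyMeasurable G Q) : ∫ ω, G (T ω) ∂P = ∫ ω, G ω ∂Q := by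
  rw [← hT.map_eq] at hG ⊢
  exact (integral_map hT.measurable.aemeasurable hG).symm

theorem integral_le_of_forall_expect_comp_le {Ω κ : Type*} [MeasurableSpace Ω] [Fintype κ]
    [Nonempty κ] {P : Measure Ω} [IsProbabilityMeasure P] {T : κ → Ω → Ω}
    (hT : ∀ k, MeasurePreserving (T k) P P) {G : Ω → ℝ} (hG : Integrable G P) {c : ℝ}
    (hc : ∀ ω, 𝔼 k, G (T k ω) ≤ c) : ∫ ω, G ω ∂P ≤ c := by
  have hint (k : κ) : Integrable (fun ω => G (T k ω)) P :=
    (hT k).integrable_comp_of_integrable hG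
  simp only [Fintype.expect_eq_sum_div_card] at hc
  calc ∫ ω, G ω ∂P = ∫ ω, (∑ k, G (T k ω)) / Fintype.card κ ∂P := by
        rw [integral_div, integral_finsetSum _ fun k _ => hint k]
        simp only [integral_comp_of_measurePreserving (hT _) hG.aestronglyMeasurable]
        rw [← Fintype.expect_eq_sum_div_card, Fintype.expect_const]
    _ ≤ ∫ _, c ∂P := integral_mono ((integrable_finsetSum _ fun k _ => hint k).div_const _)
        (integrable_const _) hc
    _ = c := by simp

/-- Exchange the two observations at the indices at which the sign `ε` is negative. -/
def swapAt (ε : Fin m → ℤˣ) (w : Fin m → Z × Z) : Fin m → Z × Z :=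
  fun t => if ε t = 1 then w t else (w t).swap

theorem sub_swapAt (ε : Fin m → ℤˣ) (w : Fin m → Z × Z) (φ : Z → ℝ) (t : Fin m) :
    φ (swapAt ε w t).1 - φ (swapAt ε w t).2 = (ε t : ℤ) * (φ (w t).1 - φ (w t).2) := by
  rcases Int.units_eq_one_or (ε t) with h | h <;> simp [swapAt, h]

theorem measurePreserving_swapAt [MeasurableSpace Z] (D : Measure Z) [IsProbabilityMeasure D]
    (ε : Fin m → ℤˣ) :
    MeasurePreserving (swapAt ε) (Measure.pi fun _ : Fin m => D.prod D)
      (Measure.pi fun _ : Fin m => D.prod D) := by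
  refine measurePreserving_pi _ _ (f := fun t (p : Z × Z) => if ε t = 1 then p else p.swap)
    fun t => ?_
  split_ifs
  exacts [MeasurePreserving.id _, Measure.measurePreserving_swap]

theorem card_sampleOf (z : Fin m → Z) : Multiset.card (sampleOf z) = m := by
  simp [sampleOf]

theorem sampleOf_swapAt_le (ε : Fin m → ℤˣ) (w : Fin m → Z × Z) :
    sampleOf (fun t => (swapAt ε w t).1) ≤
      sampleOf (fun t => (w t).1) + sampleOf (fun t => (w t).2) := by
  have hsum (z : Fin m → Z) : sampleOf z = ∑ t, {z t} := by
    rw [sampleOf, ← Multiset.sum_map_singleton (Multiset.map z _), Multiset.map_map]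
    rfl
  simp only [hsum, ← Finset.sum_add_distrib]
  gcongr with t
  unfold swapAt
  split_ifs
  exacts [Multiset.le_add_right _ _, Multiset.le_add_left _ _]

theorem empiricalReward_sampleOf {H : Type*} (rew : H → Z → ℝ) (z : Fin m → Z) (h : H) :
    empiricalReward rew (sampleOf z) h = (∑ t, rew h (z t)) / m := by
  rw [empiricalReward, card_sampleOf, sampleOf, Multiset.map_map]
  rfl

end Symmetrization

section Generalization

open scoped BigOperators

variable {H Z : Type*} {m : ℕ} {rew : H → Z → ℝ} {rule : Multiset Z → H}

/-- The total reward on the first entries of `w` minus the total reward on the second entries, for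
the hypothesis that `rule` selects from the first entries. So the first entries are the training
sample and the second ones are a hold-out sample. -/
def holdoutGap (rew : H → Z → ℝ) (rule : Multiset Z → H) (w : Fin m → Z × Z) : ℝ :=
  ∑ t, (rew (rule (sampleOf fun s => (w s).1)) (w t).1 -
    rew (rule (sampleOf fun s => (w s).1)) (w t).2)

theorem mem_splitSampleSpace_swapAt (rule : Multiset Z → H) (ε : Fin m → ℤˣ) (w : Fin m → Z × Z) :
    rule (sampleOf fun t => (swapAt ε w t).1) ∈
      splitSampleSpace rule (sampleOf (fun t => (w t).1) + sampleOf fun t => (w t).2) := by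
  refine ⟨_, sampleOf_swapAt_le ε w, ?_, rfl⟩
  simp only [Multiset.card_add, card_sampleOf, ← two_mul, Nat.cast_mul, Nat.cast_ofNat]
  rw [mul_div_cancel_left₀ _ two_ne_zero, Nat.ceil_natCast]

theorem expect_holdoutGap_swapAt_le (hrew : ∀ h z, rew h z ∈ Set.Icc 0 1) {N : ℕ}
    (hN : splitSampleGrowth rule (2 * m) ≤ N) (w : Fin m → Z × Z) :
    𝔼 ε : Fin m → ℤˣ, holdoutGap rew rule (swapAt ε w) ≤ √(2 * m * Real.log N) := by
  set S : Multiset Z := sampleOf (fun t => (w t).1) + sampleOf (fun t => (w t).2)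
  have hcard : Multiset.card S = 2 * m := by
    rw [Multiset.card_add, card_sampleOf, card_sampleOf, two_mul]
  have hS : (splitSampleSpace rule S).encard ≤ N :=
    (le_iSup₂_of_le (f := fun S (_ : Multiset.card S = 2 * m) => (splitSampleSpace rule S).encard)
      S hcard le_rfl).trans hN
  have hfin : (splitSampleSpace rule S).Finite := Set.finite_of_encard_le_coe hS
  have hmem (ε : Fin m → ℤˣ) : rule (sampleOf fun t => (swapAt ε w t).1) ∈ hfin.toFinset :=
    hfin.mem_toFinset.2 (mem_splitSampleSpace_swapAt rule ε w)
  have hsq (h : H) : ∑ t, (rew h (w t).1 - rew h (w t).2) ^ 2 ≤ (m : ℝ) := by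
    refine (Finset.sum_le_card_nsmul _ _ 1 fun t _ => ?_).trans (by simp)
    rw [sq_le_one_iff_abs_le_one]
    exact abs_sub_le_of_le_of_le (hrew _ _).1 (hrew _ _).2 (hrew _ _).1 (hrew _ _).2 |>.trans
      (by norm_num)
  simp only [holdoutGap, sub_swapAt]
  refine (expect_sum_units_mul_le_sqrt (fun h _ => hsq h) hmem).trans ?_
  have hpos : 0 < hfin.toFinset.card := Finset.card_pos.2 ⟨_, hmem 1⟩
  gcongr
  rwa [hfin.encard_eq_coe_toFinset_card, Nat.cast_le] at hS

variable [MeasurableSpace Z] {D : Measure Z} [IsProbabilityMeasure D]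

theorem measurePreserving_fst_pi (D : Measure Z) [IsProbabilityMeasure D] :
    MeasurePreserving (fun (w : Fin m → Z × Z) t => (w t).1)
      (Measure.pi fun _ => D.prod D) (Measure.pi fun _ => D) :=
  measurePreserving_pi _ _ fun _ => measurePreserving_fst

theorem measurePreserving_fst_pi_snd_apply (D : Measure Z) [IsProbabilityMeasure D] (t : Fin m) :
    MeasurePreserving (fun w : Fin m → Z × Z => ((fun s => (w s).1 : Fin m → Z), (w t).2))
      (Measure.pi fun _ => D.prod D) ((Measure.pi fun _ => D).prod D) :=
  ((MeasurePreserving.id _).prod (measurePreserving_eval (fun _ => D) t)).comp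
    (measurePreserving_arrowProdEquivProdArrow Z Z (Fin m) (fun _ => D) (fun _ => D))

theorem integral_empiricalReward (hm : 1 ≤ m) {h : H} (hint : Integrable (rew h) D) :
    ∫ S : Fin m → Z, empiricalReward rew (sampleOf S) h ∂(Measure.pi fun _ => D) =
      ∫ z, rew h z ∂D := by
  have hm0 : (m : ℝ) ≠ 0 := Nat.cast_ne_zero.2 (by omega)
  simp only [empiricalReward_sampleOf]
  rw [integral_div, integral_finsetSum _ fun t _ => integrable_comp_eval hint]
  rw [Finset.sum_congr rfl fun t _ =>
    integral_comp_eval (μ := fun _ : Fin m => D) hint.aestronglyMeasurable]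
  simp [hm0]

variable [MeasurableSpace H]

theorem integrable_train (hmeas : Measurable fun p : H × Z => rew p.1 p.2)
    (hrew : ∀ h z, rew h z ∈ Set.Icc 0 1)
    (hrule : Measurable fun S : Fin m → Z => rule (sampleOf S)) (t : Fin m) :
    Integrable (fun S : Fin m → Z => rew (rule (sampleOf S)) (S t)) (Measure.pi fun _ => D) :=
  Integrable.of_mem_Icc 0 1 (hmeas.comp (hrule.prodMk (measurable_pi_apply t))).aemeasurable
    (ae_of_all _ fun _ => hrew _ _)

theorem integrable_test (hmeas : Measurable fun p : H × Z => rew p.1 p.2)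
    (hrew : ∀ h z, rew h z ∈ Set.Icc 0 1)
    (hrule : Measurable fun S : Fin m → Z => rule (sampleOf S)) :
    Integrable (fun q : (Fin m → Z) × Z => rew (rule (sampleOf q.1)) q.2)
      ((Measure.pi fun _ => D).prod D) :=
  Integrable.of_mem_Icc 0 1
    (hmeas.comp ((hrule.comp measurable_fst).prodMk measurable_snd)).aemeasurable
    (ae_of_all _ fun _ => hrew _ _)

theorem integrable_holdoutGap (hmeas : Measurable fun p : H × Z => rew p.1 p.2)
    (hrew : ∀ h z, rew h z ∈ Set.Icc 0 1)
    (hrule : Measurable fun S : Fin m → Z => rule (sampleOf S)) :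
    Integrable (holdoutGap rew rule) (Measure.pi fun _ : Fin m => D.prod D) :=
  integrable_finsetSum _ fun t _ =>
    ((measurePreserving_fst_pi D).integrable_comp_of_integrable
      (integrable_train hmeas hrew hrule t)).sub
    ((measurePreserving_fst_pi_snd_apply D t).integrable_comp_of_integrable
      (integrable_test hmeas hrew hrule))

theorem integral_holdoutGap (hm : 1 ≤ m) (hmeas : Measurable fun p : H × Z => rew p.1 p.2)
    (hrew : ∀ h z, rew h z ∈ Set.Icc 0 1)
    (hrule : Measurable fun S : Fin m → Z => rule (sampleOf S)) :
    ∫ w : Fin m → Z × Z, holdoutGap rew rule w ∂(Measure.pi fun _ => D.prod D) =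
      m * (∫ S : Fin m → Z, empiricalReward rew (sampleOf S) (rule (sampleOf S))
            ∂(Measure.pi fun _ => D) -
        ∫ S : Fin m → Z, ∫ z, rew (rule (sampleOf S)) z ∂D ∂(Measure.pi fun _ => D)) := by
  have hm0 : (m : ℝ) ≠ 0 := Nat.cast_ne_zero.2 (by omega)
  have htrain := integrable_train (D := D) hmeas hrew hrule
  have htest := integrable_test (D := D) hmeas hrew hrule
  have hfst (t : Fin m) : Integrable
      (fun w : Fin m → Z × Z => rew (rule (sampleOf fun s => (w s).1)) (w t).1)
      (Measure.pi fun _ => D.prod D) :=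
    (measurePreserving_fst_pi D).integrable_comp_of_integrable (htrain t)
  have hsnd (t : Fin m) : Integrable
      (fun w : Fin m → Z × Z => rew (rule (sampleOf fun s => (w s).1)) (w t).2)
      (Measure.pi fun _ => D.prod D) :=
    (measurePreserving_fst_pi_snd_apply D t).integrable_comp_of_integrable htest
  calc ∫ w : Fin m → Z × Z, holdoutGap rew rule w ∂(Measure.pi fun _ => D.prod D)
      = ∑ t, (∫ S : Fin m → Z, rew (rule (sampleOf S)) (S t) ∂(Measure.pi fun _ => D) -
          ∫ S : Fin m → Z, ∫ z, rew (rule (sampleOf S)) z ∂D ∂(Measure.pi fun _ => D)) := by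
        rw [← integral_prod _ htest]
        refine (integral_finsetSum _ fun t _ => (hfst t).sub (hsnd t)).trans
          (Finset.sum_congr rfl fun t _ => (integral_sub (hfst t) (hsnd t)).trans ?_)
        exact congrArg₂ _ (integral_comp_of_measurePreserving (measurePreserving_fst_pi D)
            (htrain t).aestronglyMeasurable)
          (integral_comp_of_measurePreserving (measurePreserving_fst_pi_snd_apply D t)
            htest.aestronglyMeasurable)
    _ = _ := by
        simp only [empiricalReward_sampleOf]
        rw [integral_div, integral_finsetSum _ fun t _ => htrain t, mul_sub, mul_div_cancel₀ _ hm0]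
        simp

/-- Symmetrization: the learnt hypothesis is only compared with the outputs of `rule` on the halves
of a sample of size `2 * m`, however rich `H` is. -/
theorem integral_empiricalReward_sub_integral_le (hm : 1 ≤ m)
    (hmeas : Measurable fun p : H × Z => rew p.1 p.2) (hrew : ∀ h z, rew h z ∈ Set.Icc 0 1)
    (hrule : Measurable fun S : Fin m → Z => rule (sampleOf S)) {N : ℕ}
    (hN : splitSampleGrowth rule (2 * m) ≤ N) :
    ∫ S : Fin m → Z, empiricalReward rew (sampleOf S) (rule (sampleOf S))
          ∂(Measure.pi fun _ => D) -
        ∫ S : Fin m → Z, ∫ z, rew (rule (sampleOf S)) z ∂D ∂(Measure.pi fun _ => D) ≤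
      √(2 * Real.log N / m) := by
  have hm0 : (0 : ℝ) < m := by exact_mod_cast hm
  have hgap : ∫ w : Fin m → Z × Z, holdoutGap rew rule w ∂(Measure.pi fun _ => D.prod D) ≤
      √(2 * m * Real.log N) :=
    integral_le_of_forall_expect_comp_le (measurePreserving_swapAt D)
      (integrable_holdoutGap hmeas hrew hrule) (expect_holdoutGap_swapAt_le hrew hN)
  have hscale : √(2 * m * Real.log N) = m * √(2 * Real.log N / m) := by
    rw [← Real.sqrt_sq hm0.le, ← Real.sqrt_mul (sq_nonneg _), Real.sqrt_sq hm0.le]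
    congr 1
    field_simp
  rw [integral_holdoutGap hm hmeas hrew hrule, hscale] at hgap
  exact le_of_mul_le_mul_left hgap hm0

theorem integral_sub_sqrt_le_integral_erm (hERM : IsERM rew rule) (hm : 1 ≤ m)
    (hmeas : Measurable fun p : H × Z => rew p.1 p.2) (hrew : ∀ h z, rew h z ∈ Set.Icc 0 1)
    (hrule : Measurable fun S : Fin m → Z => rule (sampleOf S)) {N : ℕ}
    (hN : splitSampleGrowth rule (2 * m) ≤ N) (h : H) :
    ∫ z, rew h z ∂D - √(2 * Real.log N / m) ≤
      ∫ S : Fin m → Z, ∫ z, rew (rule (sampleOf S)) z ∂D ∂(Measure.pi fun _ => D) := by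
  have hint : Integrable (rew h) D :=
    Integrable.of_mem_Icc 0 1 (hmeas.comp measurable_prodMk_left).aemeasurable
      (ae_of_all _ (hrew h))
  have hoptimism : ∫ z, rew h z ∂D ≤
      ∫ S : Fin m → Z, empiricalReward rew (sampleOf S) (rule (sampleOf S))
        ∂(Measure.pi fun _ => D) := by
    rw [← integral_empiricalReward hm hint]
    refine integral_mono ?_ ?_ fun S => hERM (sampleOf S) (Set.mem_univ h)
    · simp only [empiricalReward_sampleOf]
      exact (integrable_finsetSum _ fun t _ => integrable_comp_eval hint).div_const _
    · simp only [empiricalReward_sampleOf]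
      exact (integrable_finsetSum _ fun t _ => integrable_train hmeas hrew hrule t).div_const _
  linarith [integral_empiricalReward_sub_integral_le (D := D) hm hmeas hrew hrule hN]

end Generalization

section ReserveLearning

variable {n m : ℕ} {erm : Multiset (Profile n) → (Fin n → I)}

theorem sSup_expectedRevenue_sub_sqrt_le_integral_erm
    (hERM : IsERM (fun r v => (Mechanism.secondPrice r).revenue v) erm)
    (hTie : FavorsSampleValues erm) (hm : 1 ≤ m)
    (hMeas : Measurable fun S : Fin m → Profile n => erm (sampleOf S))
    (D : Measure (Profile n)) [IsProbabilityMeasure D] :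
    sSup (Mechanism.expectedRevenue D '' Mechanism.secondPriceClass n)
        - √(2 * n * Real.log (2 * m) / m) ≤
      ∫ S : Fin m → Profile n,
        Mechanism.expectedRevenue D (Mechanism.secondPrice (erm (sampleOf S)))
        ∂(Measure.pi fun _ => D) := by
  have hgrowth : splitSampleGrowth erm (2 * m) ≤ ((2 * m) ^ n : ℕ) := by
    exact_mod_cast splitSampleGrowth_erm_le hERM hTie (by omega)
  have hlog : 2 * n * Real.log (2 * m) = 2 * Real.log ((2 * m) ^ n : ℕ) := by
    push_cast
    rw [Real.log_pow]
    ring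
  rw [hlog, sub_le_iff_le_add]
  refine csSup_le ((Set.range_nonempty _).image _) ?_
  rintro _ ⟨_, ⟨r, rfl⟩, rfl⟩
  rw [← sub_le_iff_le_add]
  exact integral_sub_sqrt_le_integral_erm hERM hm
    (Mechanism.measurable_secondPrice_revenue measurable_fst measurable_snd)
    (fun _ _ => ⟨Mechanism.secondPrice_revenue_nonneg, Mechanism.secondPrice_revenue_le_one⟩)
    hMeas hgrowth r

end ReserveLearning

/-! ### Virtual values of regular distributions -/

section MeasureIci

open Set Filter Topology

theorem antitone_measureReal_Ici {X : Type*} [Preorder X] [MeasurableSpace X] {ξ : Measure X}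
    [IsFiniteMeasure ξ] : Antitone fun a : X => ξ.real (Ici a) := fun _ _ h =>
  measureReal_mono (Ici_subset_Ici.2 h)

variable {X : Type*} [LinearOrder X] [TopologicalSpace X] [OrderTopology X] [MeasurableSpace X]
  [BorelSpace X]

theorem continuousWithinAt_measureReal_Ici [FirstCountableTopology X] (ξ : Measure X)
    [IsFiniteMeasure ξ] (a : X) : ContinuousWithinAt (fun s => ξ.real (Ici s)) (Iic a) a := by
  refine (ENNReal.tendsto_toReal (measure_ne_top _ _)).comp
    (tendsto_measure_of_tendsto_indicator_of_isFiniteMeasure _ ξ (fun _ => measurableSet_Ici)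
      fun x => ?_)
  rcases le_or_gt a x with hax | hxa
  · filter_upwards [self_mem_nhdsWithin] with s hs
    exact iff_of_true (mem_Ici.2 ((mem_Iic.1 hs).trans hax)) hax
  · filter_upwards [mem_nhdsWithin_of_mem_nhds (lt_mem_nhds hxa)] with s hs
    exact iff_of_false (not_le.2 hs) (not_le.2 hxa)

theorem upperSemicontinuous_measureReal_Ici [FirstCountableTopology X] (ξ : Measure X)
    [IsFiniteMeasure ξ] : UpperSemicontinuous fun a => ξ.real (Ici a) := by
  intro a y hy
  rw [← nhdsLE_sup_nhdsGE, eventually_sup]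
  refine ⟨(continuousWithinAt_measureReal_Ici ξ a).eventually_lt_const hy, ?_⟩
  filter_upwards [self_mem_nhdsWithin] with u hu
  exact (antitone_measureReal_Ici hu).trans_lt hy

theorem tendsto_measure_Ici_nhdsGT [FirstCountableTopology X] (ξ : Measure X) [IsFiniteMeasure ξ]
    (a : X) : Tendsto (fun s => ξ (Ici s)) (𝓝[>] a) (𝓝 (ξ (Ioi a))) := by
  rcases (𝓝[>] a).eq_or_neBot with hbot | _
  · simp [hbot]
  refine tendsto_measure_of_tendsto_indicator_of_isFiniteMeasure _ ξ
    (fun _ => measurableSet_Ici) fun x => ?_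
  rcases le_or_gt x a with hxa | hax
  · filter_upwards [self_mem_nhdsWithin] with s hs
    exact iff_of_false (hxa.trans_lt hs).not_ge hxa.not_gt
  · filter_upwards [mem_nhdsWithin_of_mem_nhds (Iio_mem_nhds hax)] with s hs
    exact iff_of_true (le_of_lt hs) hax

theorem measureReal_Ico_eq_sub (ξ : Measure X) [IsFiniteMeasure ξ] {a b : X} (hab : a ≤ b) :
    ξ.real (Ico a b) = ξ.real (Ici a) - ξ.real (Ici b) := by
  rw [← Ici_sdiff_Ici, measureReal_sdiff (Ici_subset_Ici.2 hab) measurableSet_Ici]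

variable [BoundedOrder X] [CompactIccSpace X] [DenselyOrdered X] [SecondCountableTopology X]

/-- The Stieltjes measure on the order dual has no mass at `⊤`, so the value `f ⊤` is added as an
atom. -/
theorem exists_measure_Ici_eq {f : X → ℝ} (hf : Antitone f) (hf0 : 0 ≤ f ⊤)
    (hfc : ∀ a, ContinuousWithinAt f (Iic a) a) :
    ∃ ν : Measure X, ∀ a, ν (Ici a) = ENNReal.ofReal (f a) := by
  let g : StieltjesFunction Xᵒᵈ :=
    { toFun := f ∘ OrderDual.ofDual
      mono' := hf.dual_left
      right_continuous' := hfc }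
  have hg (a : X) : g.measure.map OrderDual.ofDual (Ici a) = ENNReal.ofReal (f a - f ⊤) := by
    have hIci : OrderDual.ofDual ⁻¹' Ici a = Icc ⊥ (OrderDual.toDual a) := by
      ext x
      exact ⟨fun hx => ⟨le_top (α := X), hx⟩, fun hx => hx.2⟩
    have hbot : Function.leftLim g ⊥ = f ⊤ :=
      leftLim_eq_of_eq_bot g (by rw [Iio_bot, nhdsWithin_empty])
    have hmeas : Measurable (OrderDual.ofDual : Xᵒᵈ → X) := measurable_id (α := X)
    rw [Measure.map_apply hmeas measurableSet_Ici, hIci, g.measure_Icc, hbot]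
    rfl
  refine ⟨g.measure.map OrderDual.ofDual + ENNReal.ofReal (f ⊤) • Measure.dirac ⊤, fun a => ?_⟩
  rw [Measure.add_apply, hg, Measure.smul_apply, Measure.dirac_apply_of_mem (mem_Ici.2 le_top),
    smul_eq_mul, mul_one, ← ENNReal.ofReal_add (sub_nonneg.2 (hf le_top)) hf0, sub_add_cancel]

theorem exists_measure_le_Ici_eq (ξ : Measure X) [IsFiniteMeasure ξ] {f : X → ℝ}
    (hf : Antitone f) (hf0 : 0 ≤ f ⊤) (hfc : ∀ a, ContinuousWithinAt f (Iic a) a)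
    (hfξ : ∀ a b, a ≤ b → f a - f b ≤ ξ.real (Ico a b)) (hξ0 : f ⊤ ≤ ξ.real {⊤}) :
    ∃ ν ≤ ξ, ∀ a, ν (Ici a) = ENNReal.ofReal (f a) := by
  have hg : Antitone fun a => ξ.real (Ici a) - f a := fun a b hab => by
    have := hfξ a b hab
    rw [measureReal_Ico_eq_sub ξ hab] at this
    simp only
    linarith
  have hg0 : 0 ≤ ξ.real (Ici ⊤) - f ⊤ := by rwa [Ici_top, sub_nonneg]
  obtain ⟨ν, hν⟩ := exists_measure_Ici_eq hf hf0 hfc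
  obtain ⟨η, hη⟩ := exists_measure_Ici_eq hg hg0 fun a =>
    (continuousWithinAt_measureReal_Ici ξ a).sub (hfc a)
  have hξ : ξ = ν + η := Measure.ext_of_Ici ξ (ν + η) fun a => by
    rw [Measure.add_apply, hν, hη, ← ENNReal.ofReal_add (hf0.trans (hf le_top))
      (hg0.trans (hg le_top)), add_sub_cancel, ofReal_measureReal]
  exact ⟨ν, hξ ▸ Measure.le_add_right le_rfl, hν⟩

end MeasureIci

theorem exists_measurable_le_withDensity_eq {X : Type*} [MeasurableSpace X] {μ ν : Measure X}
    [SigmaFinite μ] [SigmaFinite ν] {g : X → ENNReal} (hg : Measurable g)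
    (hν : ν ≤ μ.withDensity g) :
    ∃ ψ : X → ENNReal, Measurable ψ ∧ ψ ≤ g ∧ μ.withDensity ψ = ν := by
  have hac : ν ≪ μ := (Measure.absolutelyContinuous_of_le hν).trans
    (withDensity_absolutelyContinuous _ _)
  have hle : ν.rnDeriv μ ≤ᵐ[μ] g :=
    ae_le_of_forall_setLIntegral_le_of_sigmaFinite (Measure.measurable_rnDeriv ν μ)
      fun s hs _ => by
        rw [Measure.setLIntegral_rnDeriv hac, ← withDensity_apply _ hs]
        exact hν s
  refine ⟨fun x => min (ν.rnDeriv μ x) (g x), (Measure.measurable_rnDeriv ν μ).min hg,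
    fun x => min_le_right _ _, ?_⟩
  exact (withDensity_congr_ae (hle.mono fun x hx => min_eq_left hx)).trans
    (Measure.withDensity_rnDeriv_eq ν μ hac)

/-- The expected revenue from offering the item at the price `θ` to a bidder with value
distribution `μ`. -/
def postedRevenue (μ : Measure I) (θ : I) : ℝ := θ * μ.real (Set.Ici θ)

section PostedRevenue

open Set Filter Topology

variable {μ : Measure I}

theorem postedRevenue_nonneg (θ : I) : 0 ≤ postedRevenue μ θ :=
  mul_nonneg θ.2.1 measureReal_nonneg

variable [IsFiniteMeasure μ]

theorem ofReal_postedRevenue (θ : I) :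
    ENNReal.ofReal (postedRevenue μ θ) = ENNReal.ofReal θ * μ (Ici θ) := by
  rw [postedRevenue, ENNReal.ofReal_mul θ.2.1, ofReal_measureReal]

theorem continuousWithinAt_postedRevenue (θ : I) :
    ContinuousWithinAt (postedRevenue μ) (Iic θ) θ :=
  continuous_subtype_val.continuousWithinAt.mul (continuousWithinAt_measureReal_Ici μ θ)

theorem upperSemicontinuous_postedRevenue : UpperSemicontinuous (postedRevenue μ) := by
  intro θ y hy
  rw [← nhdsLE_sup_nhdsGE, eventually_sup]
  refine ⟨(continuousWithinAt_postedRevenue θ).eventually_lt_const hy, ?_⟩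
  have hright : ContinuousWithinAt (fun u : I => u * μ.real (Ici θ)) (Ici θ) θ := by fun_prop
  filter_upwards [hright.eventually_lt_const hy, self_mem_nhdsWithin] with u hu hθu
  exact (mul_le_mul_of_nonneg_left (antitone_measureReal_Ici hθu) u.2.1).trans_lt hu

theorem exists_isMaxOn_postedRevenue (μ : Measure I) [IsFiniteMeasure μ] :
    ∃ r, IsMaxOn (postedRevenue μ) univ r := by
  obtain ⟨r, -, hr⟩ := (upperSemicontinuous_postedRevenue (μ := μ)).upperSemicontinuousOn univ
    |>.exists_isMaxOn univ_nonempty isCompact_univ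
  exact ⟨r, hr⟩

instance : IsFiniteMeasure (μ.withDensity fun x => ENNReal.ofReal x) :=
  isFiniteMeasure_withDensity_ofReal
    (Integrable.of_mem_Icc 0 1 (by fun_prop) (ae_of_all _ fun x => x.2)).hasFiniteIntegral

theorem mul_measureReal_le_withDensity {a : I} {s : Set I} (hs : MeasurableSet s)
    (has : s ⊆ Ici a) :
    a * μ.real s ≤ (μ.withDensity fun x => ENNReal.ofReal x).real s := by
  have hle : ENNReal.ofReal (a * μ.real s) ≤ μ.withDensity (fun x => ENNReal.ofReal x) s := by
    rw [withDensity_apply _ hs, ENNReal.ofReal_mul a.2.1, ofReal_measureReal, ← setLIntegral_const]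
    exact setLIntegral_mono' hs fun x hx => ENNReal.ofReal_le_ofReal (has hx)
  exact (ENNReal.ofReal_le_iff_le_toReal (measure_ne_top _ _)).1 hle

theorem postedRevenue_sub_le {a b : I} (hab : a ≤ b) :
    postedRevenue μ a - postedRevenue μ b
      ≤ (μ.withDensity fun x => ENNReal.ofReal x).real (Ico a b) := by
  refine le_trans ?_ (mul_measureReal_le_withDensity measurableSet_Ico Ico_subset_Ici_self)
  rw [measureReal_Ico_eq_sub μ hab, postedRevenue, postedRevenue, mul_sub]
  gcongr

end PostedRevenue

section RevenueCurve

open Set Filter Topology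

variable {μ : Measure I} [IsProbabilityMeasure μ]

theorem exists_isGreatest_eq_valueAtQuantile {q : ℝ} (hq : q ≤ 1) :
    ∃ p : I, p = valueAtQuantile μ q ∧ IsGreatest {θ : I | q ≤ μ.real (Ici θ)} p := by
  have hclosed : IsClosed {θ : I | q ≤ μ.real (Ici θ)} :=
    (upperSemicontinuous_measureReal_Ici μ).isClosed_preimage q
  have h0 : (0 : I) ∈ {θ : I | q ≤ μ.real (Ici θ)} := by
    have : Ici (0 : I) = univ := Ici_bot
    simpa [this] using hq
  obtain ⟨p, hp⟩ := hclosed.isCompact.exists_isGreatest ⟨0, h0⟩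
  have hsup : IsGreatest {x : ℝ | x ∈ Icc (0 : ℝ) 1 ∧ q ≤ μ.real {y : I | x ≤ y}} p :=
    ⟨⟨p.2, hp.1⟩, fun x hx => hp.2 (show q ≤ μ.real (Ici (⟨x, hx.1⟩ : I)) from hx.2)⟩
  exact ⟨p, hsup.csSup_eq.symm, hp⟩

theorem postedRevenue_le_mul_valueAtQuantile (θ : I) :
    postedRevenue μ θ ≤ μ.real (Ici θ) * valueAtQuantile μ (μ.real (Ici θ)) := by
  obtain ⟨p, hp, hgreatest⟩ := exists_isGreatest_eq_valueAtQuantile (μ := μ) (q := μ.real (Ici θ))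
    measureReal_le_one
  rw [← hp, postedRevenue, mul_comm]
  exact mul_le_mul_of_nonneg_left (hgreatest.2 (mem_ofPred.2 le_rfl)) measureReal_nonneg

theorem mul_valueAtQuantile_le {r : I} (hr : IsMaxOn (postedRevenue μ) univ r) {q : ℝ}
    (hq : q ≤ 1) : q * valueAtQuantile μ q ≤ postedRevenue μ r := by
  obtain ⟨p, hp, hgreatest⟩ := exists_isGreatest_eq_valueAtQuantile (μ := μ) hq
  calc q * valueAtQuantile μ q = p * q := by rw [← hp, mul_comm]
    _ ≤ postedRevenue μ p := mul_le_mul_of_nonneg_left hgreatest.1 p.2.1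
    _ ≤ postedRevenue μ r := hr (mem_univ p)

namespace IsRegularDistribution

variable {r : I}

theorem monotoneOn_mul_valueAtQuantile (hμ : IsRegularDistribution μ)
    (hr : IsMaxOn (postedRevenue μ) univ r) :
    MonotoneOn (fun q => q * valueAtQuantile μ q) (Icc 0 (μ.real (Ici r))) := by
  intro q hq q' hq' hqq'
  have hmax : q * valueAtQuantile μ q ≤ μ.real (Ici r) * valueAtQuantile μ (μ.real (Ici r)) :=
    (mul_valueAtQuantile_le hr (hq.2.trans measureReal_le_one)).trans
      (postedRevenue_le_mul_valueAtQuantile r)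
  have hmin := hμ.min_le_of_mem_Icc ⟨hq.1, hq.2.trans measureReal_le_one⟩
    ⟨measureReal_nonneg, measureReal_le_one⟩ ⟨hqq', hq'.2⟩
  rwa [min_eq_left hmax] at hmin

/-- If the quantile of `a` is smaller than that of `r`, then at slightly larger quantiles the value
is at most `a`, and the revenue curve is monotone there. -/
theorem mul_valueAtQuantile_le_postedRevenue (hμ : IsRegularDistribution μ)
    (hr : IsMaxOn (postedRevenue μ) univ r) {a : I} (hra : r ≤ a) :
    μ.real (Ici a) * valueAtQuantile μ (μ.real (Ici a)) ≤ postedRevenue μ a := by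
  rcases (antitone_measureReal_Ici (ξ := μ) hra).eq_or_lt with heq | hlt
  · calc _ ≤ r * μ.real (Ici r) := mul_valueAtQuantile_le hr measureReal_le_one
      _ ≤ a * μ.real (Ici r) := mul_le_mul_of_nonneg_right hra measureReal_nonneg
      _ = postedRevenue μ a := congrArg _ heq.symm
  · have hbound : ∀ q ∈ Ioc (μ.real (Ici a)) (μ.real (Ici r)),
        μ.real (Ici a) * valueAtQuantile μ (μ.real (Ici a)) ≤ a * q := by
      intro q hq
      obtain ⟨p, hp, hgreatest⟩ := exists_isGreatest_eq_valueAtQuantile (μ := μ)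
        (hq.2.trans measureReal_le_one)
      have hpa : p ≤ a := le_of_not_gt fun hap =>
        (hgreatest.1.trans (antitone_measureReal_Ici hap.le)).not_gt hq.1
      have h0q : 0 ≤ q := measureReal_nonneg.trans hq.1.le
      calc _ ≤ q * valueAtQuantile μ q := hμ.monotoneOn_mul_valueAtQuantile hr
            ⟨measureReal_nonneg, hlt.le⟩ ⟨h0q, hq.2⟩ hq.1.le
        _ ≤ a * q := by
          rw [← hp, mul_comm]
          exact mul_le_mul_of_nonneg_right hpa h0q
    have hlim : ContinuousWithinAt (fun q : ℝ => a * q) (Ioi (μ.real (Ici a)))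
        (μ.real (Ici a)) := by
      fun_prop
    exact ge_of_tendsto hlim (mem_of_superset (Ioc_mem_nhdsGT hlt) hbound)

theorem antitoneOn_postedRevenue (hμ : IsRegularDistribution μ)
    (hr : IsMaxOn (postedRevenue μ) univ r) : AntitoneOn (postedRevenue μ) (Ici r) := by
  intro a ha b hb hab
  calc postedRevenue μ b ≤ μ.real (Ici b) * valueAtQuantile μ (μ.real (Ici b)) :=
        postedRevenue_le_mul_valueAtQuantile b
    _ ≤ μ.real (Ici a) * valueAtQuantile μ (μ.real (Ici a)) :=
        hμ.monotoneOn_mul_valueAtQuantile hr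
          ⟨measureReal_nonneg, antitone_measureReal_Ici hb⟩
          ⟨measureReal_nonneg, antitone_measureReal_Ici ha⟩ (antitone_measureReal_Ici hab)
    _ ≤ postedRevenue μ a := hμ.mul_valueAtQuantile_le_postedRevenue hr ha

end IsRegularDistribution

/-- `ψ` is a nonnegative virtual value for the value distribution `μ` with optimal reserve `r`: the
density, with respect to `μ`, of the revenue from posted prices at least `r`. Unlike the classical
formula, this does not presuppose that `μ` has a density. -/
structure IsVirtualValue (μ : Measure I) (r : I) (ψ : I → ENNReal) : Prop where
  measurable : Measurable ψ
  le_value : ∀ x, ψ x ≤ ENNReal.ofReal x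
  eq_zero : ∀ x < r, ψ x = 0
  setLIntegral_Ici : ∀ θ, r ≤ θ →
    ∫⁻ x in Set.Ici θ, ψ x ∂μ = ENNReal.ofReal θ * μ (Set.Ici θ)
  optimal : ∀ θ : I, ENNReal.ofReal θ * μ (Set.Ici θ) ≤ ENNReal.ofReal r * μ (Set.Ici r)

namespace IsRegularDistribution

theorem exists_measure_eq_postedRevenue (hμ : IsRegularDistribution μ) {r : I}
    (hr : IsMaxOn (postedRevenue μ) univ r) :
    ∃ ν ≤ μ.withDensity fun x => ENNReal.ofReal x,
      ∀ θ, ν (Ici θ) = ENNReal.ofReal (postedRevenue μ (θ ⊔ r)) := by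
  refine exists_measure_le_Ici_eq _ ?_ (postedRevenue_nonneg _) ?_ ?_ ?_
  · exact fun a b hab => hμ.antitoneOn_postedRevenue hr (mem_Ici.2 le_sup_right)
      (mem_Ici.2 le_sup_right) (sup_le_sup_right hab r)
  · exact fun a => (continuousWithinAt_postedRevenue _).comp (by fun_prop)
      fun s hs => sup_le_sup_right hs r
  · intro a b hab
    refine (postedRevenue_sub_le (sup_le_sup_right hab r)).trans (measureReal_mono ?_)
    exact fun x hx => ⟨le_sup_left.trans hx.1,
      (lt_sup_iff.1 hx.2).resolve_right (le_sup_right.trans hx.1).not_gt⟩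
  · rw [top_sup_eq, postedRevenue, Ici_top]
    exact mul_measureReal_le_withDensity (measurableSet_singleton ⊤) (by simp)

theorem exists_isVirtualValue (hμ : IsRegularDistribution μ) :
    ∃ r ψ, IsVirtualValue μ r ψ := by
  obtain ⟨r, hr⟩ := exists_isMaxOn_postedRevenue μ
  obtain ⟨ν, hνle, hν⟩ := hμ.exists_measure_eq_postedRevenue hr
  have : IsFiniteMeasure ν := isFiniteMeasure_of_le _ hνle
  obtain ⟨ψ, hψ, hψle, hψν⟩ := exists_measurable_le_withDensity_eq
    (measurable_subtype_coe.ennreal_ofReal) hνle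
  refine ⟨r, (Ici r).indicator ψ, hψ.indicator measurableSet_Ici,
    fun x => (indicator_le_self _ _ x).trans (hψle x),
    fun x hx => indicator_of_notMem (not_le.2 hx) _, fun θ hθ => ?_, fun θ => ?_⟩
  · rw [← ofReal_postedRevenue, ← sup_eq_left.2 hθ, ← hν, ← hψν, sup_eq_left.2 hθ,
      withDensity_apply _ measurableSet_Ici]
    exact setLIntegral_congr_fun measurableSet_Ici fun x hx =>
      indicator_of_mem (mem_Ici.2 (hθ.trans hx)) _
  · rw [← ofReal_postedRevenue, ← ofReal_postedRevenue]
    exact ENNReal.ofReal_le_ofReal (hr (mem_univ θ))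

end IsRegularDistribution

end RevenueCurve

namespace IsVirtualValue

open Set Filter Topology

variable {μ : Measure I} {r : I} {ψ : I → ENNReal}

theorem volume_compl_mul_measure_Ici_le (h : IsVirtualValue μ r ψ) {U : Set I} (hU : IsUpperSet U)
    {θ : I} (hθ : θ ∈ U) : volume Uᶜ * μ (Ici θ) ≤ ∫⁻ x in U, ψ x ∂μ := by
  have hθU : Ici θ ⊆ U := hU.Ici_subset hθ
  have hvol : volume Uᶜ ≤ ENNReal.ofReal θ := by
    rw [← unitInterval.volume_Iio]
    exact measure_mono fun x hx => mem_Iio.2 (lt_of_not_ge fun hθx => hx (hθU hθx))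
  refine (mul_le_mul_left hvol _).trans ?_
  rcases le_or_gt r θ with hr | hr
  · rw [← h.setLIntegral_Ici θ hr]
    exact lintegral_mono_set hθU
  · refine (h.optimal θ).trans ?_
    rw [← h.setLIntegral_Ici r le_rfl]
    exact lintegral_mono_set ((Ici_subset_Ici.2 hr.le).trans hθU)

theorem volume_compl_mul_le [IsFiniteMeasure μ] (h : IsVirtualValue μ r ψ) {U : Set I}
    (hU : IsUpperSet U) : volume Uᶜ * μ U ≤ ∫⁻ x in U, ψ x ∂μ := by
  rw [hU.ordConnected.measurableSet.measure_eq_iSup_isCompact]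
  simp only [ENNReal.mul_iSup, iSup_le_iff]
  intro K hKU hK
  rcases K.eq_empty_or_nonempty with rfl | hne
  · simp
  · obtain ⟨θ, hθK, hθ⟩ := hK.exists_isLeast hne
    exact (mul_le_mul_right (measure_mono hθ) _).trans
      (h.volume_compl_mul_measure_Ici_le hU (hKU hθK))

theorem isFiniteMeasure_withDensity [IsFiniteMeasure μ] (h : IsVirtualValue μ r ψ) :
    IsFiniteMeasure (μ.withDensity ψ) :=
  isFiniteMeasure_of_le _ (withDensity_mono (ae_of_all _ h.le_value))

theorem setLIntegral_Ioi_le [IsFiniteMeasure μ] (h : IsVirtualValue μ r ψ) {θ : I} (hθ : r ≤ θ) :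
    ∫⁻ x in Ioi θ, ψ x ∂μ ≤ ENNReal.ofReal θ * μ (Ioi θ) := by
  rcases eq_or_ne θ ⊤ with rfl | hne
  · simp
  have hbot : (𝓝[>] θ).NeBot := nhdsGT_neBot_of_exists_gt ⟨⊤, hne.lt_top⟩
  have := h.isFiniteMeasure_withDensity
  have hprice : Tendsto (fun s : I => ENNReal.ofReal s) (𝓝[>] θ) (𝓝 (ENNReal.ofReal θ)) :=
    (ENNReal.continuous_ofReal.comp continuous_subtype_val).continuousWithinAt
  have hlim := ENNReal.Tendsto.mul hprice (Or.inr (measure_ne_top μ _))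
    (tendsto_measure_Ici_nhdsGT μ θ) (Or.inr ENNReal.ofReal_ne_top)
  have hψlim := tendsto_measure_Ici_nhdsGT (μ.withDensity ψ) θ
  rw [withDensity_apply _ measurableSet_Ioi] at hψlim
  refine le_of_tendsto_of_tendsto hψlim hlim ?_
  filter_upwards [self_mem_nhdsWithin] with s hs
  rw [withDensity_apply _ measurableSet_Ici, h.setLIntegral_Ici s (hθ.trans (le_of_lt hs))]

theorem setLIntegral_le [IsFiniteMeasure μ] (h : IsVirtualValue μ r ψ) {θ : I} (hθ : r ≤ θ)
    {U : Set I} (hU : Ioi θ ⊆ U) (hU' : U ⊆ Ici θ) :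
    ∫⁻ x in U, ψ x ∂μ ≤ ENNReal.ofReal θ * μ U := by
  obtain rfl | rfl := mem_Ici_Ioi_of_subset_of_subset hU hU'
  · exact (h.setLIntegral_Ici θ hθ).le
  · exact h.setLIntegral_Ioi_le hθ

end IsVirtualValue

/-! ### Truthful payments of one bidder -/

theorem sub_le_mul_sub_div_two_pow {f g : I → ℝ}
    (h : ∀ s t : I, s ≤ t → f t - f s ≤ (t - s) * (g t - g s)) (k : ℕ) {s t : I} (hst : s ≤ t) :
    f t - f s ≤ (t - s) * (g t - g s) / 2 ^ k := by
  induction k generalizing s t with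
  | zero => simpa using h s t hst
  | succ k ih =>
    have hst' : (s : ℝ) ≤ t := hst
    obtain ⟨m, hm⟩ : ∃ m : I, (m : ℝ) = (s + t) / 2 :=
      ⟨⟨(s + t) / 2, by linarith [s.2.1, t.2.1], by linarith [s.2.2, t.2.2]⟩, rfl⟩
    have hsm : s ≤ m := Subtype.coe_le_coe.1 (by linarith)
    have hmt : m ≤ t := Subtype.coe_le_coe.1 (by linarith)
    calc f t - f s = f t - f m + (f m - f s) := by ring
      _ ≤ (t - m) * (g t - g m) / 2 ^ k + (m - s) * (g m - g s) / 2 ^ k :=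
        add_le_add (ih hmt) (ih hsm)
      _ = (t - s) * (g t - g s) / 2 ^ (k + 1) := by
        rw [hm]
        field_simp
        ring

theorem antitone_of_sub_le_mul_sub {f g : I → ℝ}
    (h : ∀ s t : I, s ≤ t → f t - f s ≤ (t - s) * (g t - g s)) : Antitone f := by
  intro s t hst
  have hlim : Filter.Tendsto (fun k : ℕ => (t - s) * (g t - g s) / 2 ^ k) Filter.atTop (nhds 0) :=
    tendsto_const_nhds.div_atTop (tendsto_pow_atTop_atTop_of_one_lt one_lt_two)
  exact sub_nonpos.1 (ge_of_tendsto' hlim fun k => sub_le_mul_sub_div_two_pow h k hst)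

theorem lintegral_ofReal_sub_eq {Ω : Type*} [MeasurableSpace Ω] (ξ : Measure Ω) [SFinite ξ]
    {f g : Ω → ℝ} (hf : Measurable f) (hg : Measurable g) :
    ∫⁻ ω, ENNReal.ofReal (g ω - f ω) ∂ξ = ∫⁻ s : ℝ, ξ {ω | f ω ≤ s ∧ s < g ω} := by
  have hset : MeasurableSet {q : Ω × ℝ | f q.1 ≤ q.2 ∧ q.2 < g q.1} := by
    measurability
  calc ∫⁻ ω, ENNReal.ofReal (g ω - f ω) ∂ξ
      = ∫⁻ ω, volume (Set.Ico (f ω) (g ω)) ∂ξ := by simp only [Real.volume_Ico]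
    _ = ξ.prod volume {q : Ω × ℝ | f q.1 ≤ q.2 ∧ q.2 < g q.1} := (Measure.prod_apply hset).symm
    _ = ∫⁻ s : ℝ, ξ {ω | f ω ≤ s ∧ s < g ω} := Measure.prod_apply_symm hset

section OneBidder

variable {x p : I → ℝ}

theorem monotone_of_truthful (hic : ∀ b c : I, (c : ℝ) * x b - p b ≤ c * x c - p c) :
    Monotone x := by
  intro b c hbc
  rcases hbc.eq_or_lt with rfl | hlt
  · exact le_rfl
  have hlt' : (b : ℝ) < c := hlt
  refine le_of_mul_le_mul_left ?_ (sub_pos.2 hlt')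
  linarith [hic b c, hic c b]

theorem integrable_max_sub (hx : Monotone x) (c : I) :
    Integrable fun z : I => max (x c - x z) 0 :=
  Integrable.of_mem_Icc 0 (max (x c - x 0) 0)
    ((measurable_const.sub hx.measurable).max measurable_const).aemeasurable
    (ae_of_all _ fun z => ⟨le_max_right _ _,
      max_le_max_right 0 (sub_le_sub_left (hx z.2.1) (x c))⟩)

theorem mul_sub_le_integral_max_sub (hx : Monotone x) {c d : I} (hcd : c ≤ d) :
    c * (x d - x c) ≤ (∫ z : I, max (x d - x z) 0) - ∫ z : I, max (x c - x z) 0 := by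
  calc c * (x d - x c) = ∫ z, (Set.Iic c).indicator (fun _ => x d - x c) z := by
        simp [integral_indicator_const, measureReal_def, c.2.1]
    _ ≤ ∫ z : I, (max (x d - x z) 0 - max (x c - x z) 0) := by
        refine integral_mono ((integrable_const _).indicator measurableSet_Iic)
          ((integrable_max_sub hx d).sub (integrable_max_sub hx c)) fun z => ?_
        have hxcd := hx hcd
        by_cases hz : z ∈ Set.Iic c
        · have hxzc := hx hz
          simp only [Set.indicator_of_mem hz]
          rw [max_eq_left (by linarith), max_eq_left (by linarith)]
          linarith
        · simp only [Set.indicator_of_notMem hz, sub_nonneg]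
          exact max_le_max_right 0 (sub_le_sub_right hxcd _)
    _ = _ := integral_sub (integrable_max_sub hx d) (integrable_max_sub hx c)

theorem payment_le_integral (hic : ∀ b c : I, (c : ℝ) * x b - p b ≤ c * x c - p c)
    (hir : ∀ b : I, 0 ≤ (b : ℝ) * x b - p b) (b : I) :
    p b ≤ ∫ z : I, max (x b - x z) 0 := by
  have hx := monotone_of_truthful hic
  have hanti : Antitone fun c => p c - ∫ z : I, max (x c - x z) 0 :=
    antitone_of_sub_le_mul_sub (g := x) fun c d hcd => by
      linarith [hic c d, mul_sub_le_integral_max_sub hx hcd]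
  have hb : p b - ∫ z : I, max (x b - x z) 0 ≤ p 0 - ∫ z : I, max (x 0 - x z) 0 := hanti b.2.1
  have hintegral_nonneg : 0 ≤ ∫ z : I, max (x 0 - x z) 0 :=
    integral_nonneg fun z => le_max_right _ _
  have hp0 : p 0 ≤ 0 := by simpa using hir 0
  linarith

theorem ofReal_payment_le (hic : ∀ b c : I, (c : ℝ) * x b - p b ≤ c * x c - p c)
    (hir : ∀ b : I, 0 ≤ (b : ℝ) * x b - p b) (b : I) :
    ENNReal.ofReal (p b) ≤ ∫⁻ z : I, ENNReal.ofReal (x b - x z) := by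
  refine (ENNReal.ofReal_le_ofReal (payment_le_integral hic hir b)).trans_eq ?_
  rw [ofReal_integral_eq_lintegral_ofReal (integrable_max_sub (monotone_of_truthful hic) b)
    (ae_of_all _ fun z => le_max_right _ _)]
  simp

theorem IsVirtualValue.lintegral_payment_le {μ : Measure I} [IsFiniteMeasure μ] {r : I}
    {ψ : I → ENNReal} (h : IsVirtualValue μ r ψ) (hx0 : ∀ b, 0 ≤ x b)
    (hic : ∀ b c : I, (c : ℝ) * x b - p b ≤ c * x c - p c)
    (hir : ∀ b : I, 0 ≤ (b : ℝ) * x b - p b) :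
    ∫⁻ b, ENNReal.ofReal (p b) ∂μ ≤ ∫⁻ b, ENNReal.ofReal (x b) * ψ b ∂μ := by
  have hx := monotone_of_truthful hic
  have hxm : Measurable x := hx.measurable
  have := h.isFiniteMeasure_withDensity
  calc ∫⁻ b, ENNReal.ofReal (p b) ∂μ
      ≤ ∫⁻ b, (∫⁻ z : I, ENNReal.ofReal (x b - x z)) ∂μ :=
        lintegral_mono fun b => ofReal_payment_le hic hir b
    _ = ∫⁻ q : I × I, ENNReal.ofReal (x q.2 - x q.1) ∂volume.prod μ :=
        (lintegral_prod_symm' (fun q : I × I => ENNReal.ofReal (x q.2 - x q.1))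
          (by fun_prop)).symm
    _ = ∫⁻ s : ℝ, volume {z | x z ≤ s} * μ {b | s < x b} := by
        rw [lintegral_ofReal_sub_eq _ (by fun_prop) (by fun_prop)]
        exact lintegral_congr fun s => Measure.prod_prod {z | x z ≤ s} {b | s < x b}
    _ ≤ ∫⁻ s : ℝ, μ.withDensity ψ {b | 0 ≤ s ∧ s < x b} := by
        refine lintegral_mono fun s => ?_
        rcases lt_or_ge s 0 with hs | hs
        · have hempty : {z | x z ≤ s} = ∅ :=
            Set.eq_empty_of_forall_notMem fun z hz => (hs.trans_le (hx0 z)).not_ge hz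
          simp [hempty]
        · have hU : IsUpperSet {b | s < x b} := fun b c hbc hb => lt_of_lt_of_le hb (hx hbc)
          have hcompl : {z | x z ≤ s} = {b | s < x b}ᶜ := by ext; simp
          simp only [hs, true_and, hcompl]
          rw [withDensity_apply _ (measurableSet_lt measurable_const hxm)]
          exact h.volume_compl_mul_le hU
    _ = ∫⁻ b, ENNReal.ofReal (x b) ∂(μ.withDensity ψ) := by
        simpa using (lintegral_ofReal_sub_eq (μ.withDensity ψ) measurable_const hxm (f := 0)).symm
    _ = ∫⁻ b, ENNReal.ofReal (x b) * ψ b ∂μ := by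
        rw [lintegral_withDensity_eq_lintegral_mul _ h.measurable hxm.ennreal_ofReal]
        exact lintegral_congr fun b => mul_comm _ _

end OneBidder

/-! ### Second-price auctions against truthful mechanisms -/

namespace Mechanism

variable {n : ℕ} {h : Mechanism n} {r : Fin n → I} {ψ : Fin n → I → ENNReal}

theorem IsTruthful.revenue_le_one (hh : h.IsTruthful) (v : Profile n) : h.revenue v ≤ 1 := by
  refine (Finset.sum_le_sum fun i _ => ?_).trans (hh.sum_alloc_le_one v)
  have hwelfare : (v i : ℝ) * h.alloc v i ≤ h.alloc v i :=
    mul_le_of_le_one_left (hh.alloc_nonneg v i) (v i).2.2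
  linarith [hh.individually_rational i v]

theorem integrable_secondPrice_revenue (D : Measure (Profile n)) [IsFiniteMeasure D]
    (r : Fin n → I) : Integrable (secondPrice r).revenue D :=
  Integrable.of_mem_Icc 0 1
    (measurable_secondPrice_revenue measurable_const measurable_id).aemeasurable
    (ae_of_all _ fun _ => ⟨secondPrice_revenue_nonneg, secondPrice_revenue_le_one⟩)

theorem bddAbove_truthfulClass (D : Measure (Profile n)) [IsFiniteMeasure D] :
    BddAbove (expectedRevenue D '' truthfulClass D) := by
  refine ⟨∫ _, 1 ∂D, ?_⟩
  rintro _ ⟨h, hh, rfl⟩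
  exact integral_mono hh.2 (integrable_const 1) hh.1.revenue_le_one

theorem bddAbove_secondPriceClass (D : Measure (Profile n)) [IsFiniteMeasure D] :
    BddAbove (expectedRevenue D '' secondPriceClass n) := by
  refine ⟨∫ _, 1 ∂D, ?_⟩
  rintro _ ⟨_, ⟨r, rfl⟩, rfl⟩
  exact integral_mono (integrable_secondPrice_revenue D r) (integrable_const 1) fun _ =>
    secondPrice_revenue_le_one

theorem expectedRevenue_secondPrice_nonneg (D : Measure (Profile n)) (r : Fin n → I) :
    0 ≤ expectedRevenue D (secondPrice r) :=
  integral_nonneg fun _ => secondPrice_revenue_nonneg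

/-- The virtual surplus of the mechanism `h` on a profile: the expected virtual value of the bidder
who gets the item, where `ψ i` is the virtual value function of bidder `i`. Negative allocation
probabilities count as zero. -/
noncomputable def virtualSurplus (ψ : Fin n → I → ENNReal) (h : Mechanism n) (v : Profile n) :
    ENNReal :=
  ∑ i, ENNReal.ofReal (h.alloc v i) * ψ i (v i)

theorem virtualSurplus_secondPrice_of_wins {v : Profile n} {i : Fin n} (hi : Wins r v i) :
    virtualSurplus ψ (secondPrice r) v = ψ i (v i) := by
  rw [virtualSurplus, Finset.sum_eq_single i _ (by simp), secondPrice_alloc_of_wins hi]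
  · simp
  · intro j _ hj
    rw [secondPrice_alloc_of_not_wins fun hw => hj (hw.eq hi)]
    simp

theorem IsTruthful.virtualSurplus_le (hh : h.IsTruthful) {v : Profile n} {c : ENNReal}
    (hc : ∀ i, ψ i (v i) ≤ c) : virtualSurplus ψ h v ≤ c := by
  calc virtualSurplus ψ h v ≤ ∑ i, ENNReal.ofReal (h.alloc v i) * c :=
        Finset.sum_le_sum fun i _ => mul_le_mul_right (hc i) _
    _ = ENNReal.ofReal (∑ i, h.alloc v i) * c := by
        rw [← Finset.sum_mul, ENNReal.ofReal_sum_of_nonneg fun i _ => hh.alloc_nonneg v i]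
    _ ≤ c := mul_le_of_le_one_left' (ENNReal.ofReal_le_one.2 (hh.sum_alloc_le_one v))

section VirtualValues

variable {μ : Fin n → Measure I}

/-- A bidder who does not win has a value at most the price, and one who is not eligible has
virtual value `0`. -/
theorem virtualValue_le (hψ : ∀ i, IsVirtualValue (μ i) (r i) (ψ i)) (v : Profile n) (j : Fin n) :
    ψ j (v j) ≤
      virtualSurplus ψ (secondPrice r) v + ENNReal.ofReal ((secondPrice r).revenue v) := by
  rcases lt_or_ge (v j) (r j) with hlt | hge
  · simp [(hψ j).eq_zero _ hlt]
  have hj : j ∈ eligible r v := mem_eligible.2 hge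
  obtain ⟨i, hi⟩ := exists_wins ⟨j, hj⟩
  rw [virtualSurplus_secondPrice_of_wins hi, secondPrice_revenue_of_wins hi]
  rcases eq_or_ne j i with rfl | hji
  · exact le_self_add
  · exact le_add_left (((hψ j).le_value _).trans (ENNReal.ofReal_le_ofReal (le_price_of_ne hj hji)))

variable [∀ i, IsFiniteMeasure (μ i)]

theorem IsTruthful.lintegral_pay_le (hh : h.IsTruthful) {i : Fin n} {ρ : I} {φ : I → ENNReal}
    (hφ : IsVirtualValue (μ i) ρ φ) :
    ∫⁻ v, ENNReal.ofReal (h.pay v i) ∂(Measure.pi μ) ≤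
      ∫⁻ v, ENNReal.ofReal (h.alloc v i) * φ (v i) ∂(Measure.pi μ) := by
  refine lintegral_le_of_lmarginal_le {i} (hh.measurable_pay i).ennreal_ofReal
    ((hh.measurable_alloc i).ennreal_ofReal.mul (hφ.measurable.comp (measurable_pi_apply i)))
    fun v => ?_
  simp only [lmarginal_singleton, Function.update_self]
  refine hφ.lintegral_payment_le (fun b => hh.alloc_nonneg _ i) (fun b c => ?_) fun b => ?_
  · simpa using hh.dominant_strategy i (Function.update v i c) b
  · simpa using hh.individually_rational i (Function.update v i b)

theorem IsTruthful.lintegral_revenue_le (hh : h.IsTruthful)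
    (hψ : ∀ i, IsVirtualValue (μ i) (r i) (ψ i)) :
    ∫⁻ v, ENNReal.ofReal (h.revenue v) ∂(Measure.pi μ) ≤
      ∫⁻ v, virtualSurplus ψ h v ∂(Measure.pi μ) := by
  calc ∫⁻ v, ENNReal.ofReal (h.revenue v) ∂(Measure.pi μ)
      ≤ ∫⁻ v, ∑ i, ENNReal.ofReal (h.pay v i) ∂(Measure.pi μ) :=
        lintegral_mono fun v => Finset.le_sum_of_subadditive ENNReal.ofReal
          ENNReal.ofReal_zero.le (fun _ _ => ENNReal.ofReal_add_le) _ _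
    _ = ∑ i, ∫⁻ v, ENNReal.ofReal (h.pay v i) ∂(Measure.pi μ) :=
        lintegral_finsetSum _ fun i _ => (hh.measurable_pay i).ennreal_ofReal
    _ ≤ ∑ i, ∫⁻ v, ENNReal.ofReal (h.alloc v i) * ψ i (v i) ∂(Measure.pi μ) :=
        Finset.sum_le_sum fun i _ => hh.lintegral_pay_le (hψ i)
    _ = ∫⁻ v, virtualSurplus ψ h v ∂(Measure.pi μ) :=
        (lintegral_finsetSum _ fun i _ => (hh.measurable_alloc i).ennreal_ofReal.mul
          ((hψ i).measurable.comp (measurable_pi_apply i))).symm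

theorem setLIntegral_wins_le (v : Profile n) {i : Fin n} {φ : I → ENNReal}
    (hφ : IsVirtualValue (μ i) (r i) φ) :
    ∫⁻ b in {b | Wins r (Function.update v i b) i}, φ b ∂(μ i) ≤
      ENNReal.ofReal (price r v i) * μ i {b | Wins r (Function.update v i b) i} := by
  refine hφ.setLIntegral_le le_sup_left (fun b hb => wins_of_price_lt ?_) fun b hb => ?_
  · rwa [price_update, Function.update_self]
  · have hprice := Wins.price_le hb
    rwa [price_update, Function.update_self] at hprice

theorem lintegral_alloc_mul_le_lintegral_pay {i : Fin n} {φ : I → ENNReal}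
    (hφ : IsVirtualValue (μ i) (r i) φ) :
    ∫⁻ v, ENNReal.ofReal ((secondPrice r).alloc v i) * φ (v i) ∂(Measure.pi μ) ≤
      ∫⁻ v, ENNReal.ofReal ((secondPrice r).pay v i) ∂(Measure.pi μ) := by
  have halloc : Measurable fun v => (secondPrice r).alloc v i :=
    measurable_secondPrice_alloc measurable_const measurable_id i
  have hpay : Measurable fun v => (secondPrice r).pay v i :=
    measurable_secondPrice_pay measurable_const measurable_id i
  refine lintegral_le_of_lmarginal_le {i} (halloc.ennreal_ofReal.mul
    (hφ.measurable.comp (measurable_pi_apply i))) hpay.ennreal_ofReal fun v => ?_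
  simp only [lmarginal_singleton, Function.update_self]
  set W : Set I := {b | Wins r (Function.update v i b) i}
  have hWm : MeasurableSet W :=
    (measurable_const.prodMk (measurable_update v)) (measurableSet_wins i)
  have hsurplus : ∫⁻ b, ENNReal.ofReal ((secondPrice r).alloc (Function.update v i b) i) * φ b
      ∂(μ i) = ∫⁻ b in W, φ b ∂(μ i) := by
    rw [← lintegral_indicator hWm]
    refine lintegral_congr fun b => ?_
    by_cases hb : b ∈ W
    · simp [secondPrice_alloc_of_wins hb, hb]
    · simp [secondPrice_alloc_of_not_wins hb, hb]
  have hrevenue : ∫⁻ b, ENNReal.ofReal ((secondPrice r).pay (Function.update v i b) i) ∂(μ i) =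
      ENNReal.ofReal (price r v i) * μ i W := by
    rw [← lintegral_indicator_const hWm]
    refine lintegral_congr fun b => ?_
    by_cases hb : b ∈ W
    · simp [secondPrice_pay_of_wins hb, price_update, hb]
    · simp [secondPrice_pay_of_not_wins hb, hb]
  rw [hsurplus, hrevenue]
  exact setLIntegral_wins_le v hφ

theorem lintegral_virtualSurplus_secondPrice_le (hψ : ∀ i, IsVirtualValue (μ i) (r i) (ψ i)) :
    ∫⁻ v, virtualSurplus ψ (secondPrice r) v ∂(Measure.pi μ) ≤
      ∫⁻ v, ENNReal.ofReal ((secondPrice r).revenue v) ∂(Measure.pi μ) := by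
  have halloc (i : Fin n) : Measurable fun v => (secondPrice r).alloc v i :=
    measurable_secondPrice_alloc measurable_const measurable_id i
  have hpay (i : Fin n) : Measurable fun v => (secondPrice r).pay v i :=
    measurable_secondPrice_pay measurable_const measurable_id i
  calc ∫⁻ v, virtualSurplus ψ (secondPrice r) v ∂(Measure.pi μ)
      = ∑ i, ∫⁻ v, ENNReal.ofReal ((secondPrice r).alloc v i) * ψ i (v i) ∂(Measure.pi μ) :=
        lintegral_finsetSum _ fun i _ => (halloc i).ennreal_ofReal.mul
          ((hψ i).measurable.comp (measurable_pi_apply i))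
    _ ≤ ∑ i, ∫⁻ v, ENNReal.ofReal ((secondPrice r).pay v i) ∂(Measure.pi μ) :=
        Finset.sum_le_sum fun i _ => lintegral_alloc_mul_le_lintegral_pay (hψ i)
    _ = ∫⁻ v, ENNReal.ofReal ((secondPrice r).revenue v) ∂(Measure.pi μ) := by
        rw [← lintegral_finsetSum _ fun i _ => (hpay i).ennreal_ofReal]
        simp only [revenue, ENNReal.ofReal_sum_of_nonneg fun _ _ => secondPrice_pay_nonneg]

theorem IsTruthful.lintegral_revenue_le_two_mul (hh : h.IsTruthful)
    (hψ : ∀ i, IsVirtualValue (μ i) (r i) (ψ i)) :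
    ∫⁻ v, ENNReal.ofReal (h.revenue v) ∂(Measure.pi μ) ≤
      2 * ∫⁻ v, ENNReal.ofReal ((secondPrice r).revenue v) ∂(Measure.pi μ) := by
  have hrev : Measurable fun v => ENNReal.ofReal ((secondPrice r).revenue v) :=
    (measurable_secondPrice_revenue measurable_const measurable_id).ennreal_ofReal
  calc ∫⁻ v, ENNReal.ofReal (h.revenue v) ∂(Measure.pi μ)
      ≤ ∫⁻ v, virtualSurplus ψ h v ∂(Measure.pi μ) := hh.lintegral_revenue_le hψ
    _ ≤ ∫⁻ v, virtualSurplus ψ (secondPrice r) v +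
          ENNReal.ofReal ((secondPrice r).revenue v) ∂(Measure.pi μ) :=
        lintegral_mono fun v => hh.virtualSurplus_le (virtualValue_le hψ v)
    _ = ∫⁻ v, virtualSurplus ψ (secondPrice r) v ∂(Measure.pi μ) +
          ∫⁻ v, ENNReal.ofReal ((secondPrice r).revenue v) ∂(Measure.pi μ) :=
        lintegral_add_right _ hrev
    _ ≤ 2 * ∫⁻ v, ENNReal.ofReal ((secondPrice r).revenue v) ∂(Measure.pi μ) := by
        rw [two_mul]
        exact add_le_add_left (lintegral_virtualSurplus_secondPrice_le hψ) _

theorem expectedRevenue_le_two_mul (hψ : ∀ i, IsVirtualValue (μ i) (r i) (ψ i))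
    (hh : h ∈ truthfulClass (Measure.pi μ)) :
    expectedRevenue (Measure.pi μ) h ≤ 2 * expectedRevenue (Measure.pi μ) (secondPrice r) := by
  have hrev : ENNReal.ofReal (expectedRevenue (Measure.pi μ) (secondPrice r)) =
      ∫⁻ v, ENNReal.ofReal ((secondPrice r).revenue v) ∂(Measure.pi μ) :=
    ofReal_integral_eq_lintegral_ofReal (integrable_secondPrice_revenue _ r)
      (ae_of_all _ fun v => secondPrice_revenue_nonneg)
  have hle := hh.1.lintegral_revenue_le_two_mul hψ
  rw [← hrev, ← ENNReal.ofReal_ofNat, ← ENNReal.ofReal_mul zero_le_two] at hle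
  have hnonneg := expectedRevenue_secondPrice_nonneg (Measure.pi μ) r
  calc expectedRevenue (Measure.pi μ) h
      ≤ (∫⁻ v, ENNReal.ofReal (h.revenue v) ∂(Measure.pi μ)).toReal := by
        rw [expectedRevenue, integral_eq_lintegral_pos_part_sub_lintegral_neg_part hh.2]
        exact sub_le_self _ ENNReal.toReal_nonneg
    _ ≤ 2 * expectedRevenue (Measure.pi μ) (secondPrice r) :=
        ENNReal.toReal_le_of_le_ofReal (by positivity) hle

end VirtualValues

theorem half_sSup_truthfulClass_le {μ : Fin n → Measure I} [∀ i, IsProbabilityMeasure (μ i)]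
    (hμ : ∀ i, IsRegularDistribution (μ i)) :
    (1 / 2 : ℝ) * sSup (expectedRevenue (Measure.pi μ) '' truthfulClass (Measure.pi μ))
      ≤ sSup (expectedRevenue (Measure.pi μ) '' secondPriceClass n) := by
  choose r ψ hψ using fun i => (hμ i).exists_isVirtualValue
  have hsecondPrice : expectedRevenue (Measure.pi μ) (secondPrice r) ≤
      sSup (expectedRevenue (Measure.pi μ) '' secondPriceClass n) :=
    le_csSup (bddAbove_secondPriceClass _) ⟨_, ⟨r, rfl⟩, rfl⟩
  have htruthful : sSup (expectedRevenue (Measure.pi μ) '' truthfulClass (Measure.pi μ)) ≤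
      2 * expectedRevenue (Measure.pi μ) (secondPrice r) := by
    refine Real.sSup_le ?_ (mul_nonneg zero_le_two (expectedRevenue_secondPrice_nonneg _ r))
    rintro _ ⟨h, hh, rfl⟩
    exact expectedRevenue_le_two_mul hψ hh
  linarith

end Mechanism

theorem mainTheorem4_general (n : ℕ)
    (erm : Multiset (Profile n) → (Fin n → I))
    (hERM : IsERM (fun r v => (Mechanism.secondPrice r).revenue v) erm)
    (hTie : FavorsSampleValues erm)
    (hMeas : ∀ m : ℕ, Measurable fun S : Fin m → Profile n => erm (sampleOf S)) :
    (∀ m : ℕ, 1 ≤ m → splitSampleGrowth erm m ≤ (m : ℕ∞) ^ n) ∧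
    ∀ (D : Measure (Profile n)) [IsProbabilityMeasure D],
      BddAbove (Mechanism.expectedRevenue D '' Mechanism.secondPriceClass n) ∧
      BddAbove (Mechanism.expectedRevenue D '' Mechanism.truthfulClass D) ∧
      (∀ m : ℕ, 1 ≤ m →
        sSup (Mechanism.expectedRevenue D '' Mechanism.secondPriceClass n)
            - √(2 * n * Real.log (2 * m) / m)
          ≤ ∫ S : Fin m → Profile n,
              Mechanism.expectedRevenue D (Mechanism.secondPrice (erm (sampleOf S)))
              ∂(Measure.pi fun _ => D)) ∧
      ∀ (μ : Fin n → Measure I) [∀ i, IsProbabilityMeasure (μ i)], D = Measure.pi μ →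
        (∀ i, IsRegularDistribution (μ i)) →
          (1 / 2 : ℝ) * sSup (Mechanism.expectedRevenue D '' Mechanism.truthfulClass D)
            ≤ sSup (Mechanism.expectedRevenue D '' Mechanism.secondPriceClass n) ∧
          ∀ m : ℕ, 1 ≤ m →
            (1 / 2 : ℝ) * sSup (Mechanism.expectedRevenue D '' Mechanism.truthfulClass D)
                - √(2 * n * Real.log (2 * m) / m)
              ≤ ∫ S : Fin m → Profile n,
                  Mechanism.expectedRevenue D (Mechanism.secondPrice (erm (sampleOf S)))
                  ∂(Measure.pi fun _ => D) := by
  refine ⟨fun m hm => splitSampleGrowth_erm_le hERM hTie hm, fun D _ => ?_⟩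
  have hlearn (m : ℕ) (hm : 1 ≤ m) :=
    sSup_expectedRevenue_sub_sqrt_le_integral_erm hERM hTie hm (hMeas m) D
  refine ⟨Mechanism.bddAbove_secondPriceClass D, Mechanism.bddAbove_truthfulClass D, hlearn, ?_⟩
  rintro μ _ rfl hμ
  have hhalf := Mechanism.half_sSup_truthfulClass_le hμ
  exact ⟨hhalf, fun m hm => (sub_le_sub_right hhalf _).trans (hlearn m hm)⟩

theorem mainTheorem4 (n : ℕ)
    (erm : Multiset (Profile n) → (Fin n → unitInterval))
    (hERM : IsERM (fun r v => (Mechanism.secondPrice r).revenue v) erm)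
    (hTie : FavorsSampleValues erm)
    (hMeas : ∀ m : ℕ, Measurable fun S : Fin m → Profile n => erm (sampleOf S)) :
    (∀ m : ℕ, 1 ≤ m → splitSampleGrowth erm m ≤ (m : ℕ∞) ^ n) ∧
    ∀ (μ : Fin n → MeasureTheory.Measure unitInterval)
      [∀ i, MeasureTheory.IsProbabilityMeasure (μ i)]
      (D : MeasureTheory.Measure (Profile n)), D = MeasureTheory.Measure.pi μ →
      BddAbove (Mechanism.expectedRevenue D '' Mechanism.secondPriceClass n) ∧
      BddAbove (Mechanism.expectedRevenue D '' Mechanism.truthfulClass D) ∧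
      (∀ m : ℕ, 1 ≤ m →
        sSup (Mechanism.expectedRevenue D '' Mechanism.secondPriceClass n)
            - √(2 * n * Real.log (2 * m) / m)
          ≤ ∫ S : Fin m → Profile n,
              Mechanism.expectedRevenue D (Mechanism.secondPrice (erm (sampleOf S)))
              ∂(MeasureTheory.Measure.pi fun _ => D)) ∧
      ((∀ i, IsRegularDistribution (μ i)) →
        (1 / 2 : ℝ) * sSup (Mechanism.expectedRevenue D '' Mechanism.truthfulClass D)
          ≤ sSup (Mechanism.expectedRevenue D '' Mechanism.secondPriceClass n) ∧
        ∀ m : ℕ, 1 ≤ m →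
          (1 / 2 : ℝ) * sSup (Mechanism.expectedRevenue D '' Mechanism.truthfulClass D)
              - √(2 * n * Real.log (2 * m) / m)
            ≤ ∫ S : Fin m → Profile n,
                Mechanism.expectedRevenue D (Mechanism.secondPrice (erm (sampleOf S)))
                ∂(MeasureTheory.Measure.pi fun _ => D)) := by
  obtain ⟨hgrowth, hD⟩ := mainTheorem4_general n erm hERM hTie hMeas
  refine ⟨hgrowth, ?_⟩
  rintro μ _ D rfl
  obtain ⟨hsecondPrice, htruthful, hlearn, hregular⟩ := hD (Measure.pi μ)
  exact ⟨hsecondPrice, htruthful, hlearn, hregular μ rfl⟩
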